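/- **Conventions.** Let $\{\kappa,\kappa'\}=\xi\eta'-\eta\xi'$ for $\kappa=(\xi,\eta),\ \kappa'=(\xi',\eta')\in\mathbb C^2$. Identify Minkowski space $\mathbb R^{1,3}$ with the Hermitian $2\times 2$ matrices by $(T,X,Y,Z)\mapsto\frac12\begin{pmatrix}T+Z&X+iY\\X-iY&T-Z\end{pmatrix}$, with $A\in SL(2,\mathbb C)$ acting by $S\mapsto ASA^*$; let $\mathbb H^3$ be the hyperboloid $\langle x,x\rangle=1$, $T>0$, with $\partial\mathbb H^3=\mathbb C\cup\{\infty\}$, and let $\mathbb H^2\subset\mathbb H^3$ be the slice $Y=0$, with $\partial\mathbb H^2=\mathbb R\cup\{\infty\}$. A horosphere is a set $\{x\in\mathbb H^3:\langle x,p\rangle=1\}$ with $p$ on the future light cone, and similarly for horocycles in $\mathbb H^2$. A frame is a right-handed orthonormal frame $(f_1,f_2,f_3)$ at a point of $\mathbb H^3$; spin frames are the points of the spin double cover of the frame bundle, on which $SL(2,\mathbb C)$ acts simply transitively. A *spin decoration* of a horosphere is a pair $(W^{in},W^{out})$ of continuous lifts to spin frames of the frame fields $(N^{in},v,N^{in}\times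 v)$ and $(N^{out},v,N^{out}\times v)$, where $v$ is a unit parallel tangent vector field (one invariant under the parabolic isometries preserving the horosphere), $N^{out}=-N^{in}$ is the unit normal towards the centre, and $W^{in}$ is obtained from $W^{out}$ by rotation by $\pi$ about $v$. The *complex lambda length* from $(H_1,W_1)$ to $(H_2,W_2)$ is $\exp\left(\frac{\rho+i\theta}{2}\right)$, where translation by signed distance $\rho$ along the geodesic from the centre of $H_1$ to that of $H_2$, followed by rotation by $\theta$ about it, takes $W_1^{in}$ to $W_2^{out}$ at the points where the geodesic meets $H_1$ and $H_2$; it is $0$ if the centres agree. The *lambda length* of two horocycles in $\mathbb H^2$ with distinct centres is $\exp(\rho/2)$, where $\rho$ is the signed distance from the first to the second along the geodesic from the first centre to the second. **Spaces.** The decorated Teichmüller space $\widetilde T(d)$ is the space of $d$-tuples of horocycles in $\mathbb H^2$ whose centres are distinct and in cyclic order around $\mathbb R\cup\{\infty\}$, in the negative real direction (decorated ideal $d$-gons), modulo orientation-preserving isometries of $\mathbb H^2$, i.e. modulo $PSL(2,\mathbb R)$. The space $\widetilde T^3(d)$ is the space of $d$-tuples of spin-decorated horospheres in $\mathbb H^3$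 with distinct centres (spin-decorated skew ideal $d$-gons), modulo $SL(2,\mathbb C)$. For a $2\times d$ matrix with rows $R_1,R_2$, the Plücker coordinates $p_{ij}$ of $R_1\wedge R_2$ are the minors on columns $i$ and $j$. The affine cone $X^+(d)$ on the positive Grassmannian $Gr^+(2,d)$ is the set of elements $R_1\wedge R_2\in\Lambda^2(\mathbb R^d)$ with $p_{ij}>0$ for all $i<j$. The affine cone $X^*(d)$ on the subset of $Gr_{\mathbb C}(2,d)$ where all Plücker coordinates are nonzero is the set of elements $R_1\wedge R_2\in\Lambda^2(\mathbb C^d)$ with $p_{ij}\ne0$ for all $i<j$. **Theorem.** There is an $SL(2,\mathbb C)$-equivariant homeomorphism $\Psi$ from $\mathbb C^2\setminus\{0\}$ to the space of spin-decorated horospheres, such that for each $\kappa=(\xi,\eta)$ the horosphere of $\Psi(\kappa)$ is that of $p=\kappa\kappa^*$, and its decoration at each point is a linear combination of $p$ and $\kappa\nu^*+\nu\kappa^*$, with a positive coefficient of the latter, where $\nu=(i\bar\eta,-i\bar\xi)$. Moreover, for every $d\ge3$, $\Psi$ yields the following identifications. (i) There is a homeomorphism $\widetilde T(d)\to X^+(d)$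 under which the classes of decorated ideal $d$-gons correspond to elements of $X^+(d)$ as follows. For all real spinors $\kappa_1,\dots,\kappa_d$ with $\{\kappa_i,\kappa_j\}>0$ for $i<j$ there is a decorated ideal $d$-gon whose $i$-th horocycle has $\Psi(\kappa_i)$ as a planar spin decoration for every $i$ (i.e. the horosphere of $\Psi(\kappa_i)$ extends the horocycle, and along it the decoration is the unit normal $\partial_Y$ to $\mathbb H^2$), and its class is mapped to $R_1\wedge R_2$, where $R_1,R_2$ are the rows of the matrix with columns $\kappa_1,\dots,\kappa_d$; every decorated ideal $d$-gon arises in this way. The lambda length between the $i$-th and $j$-th horocycles is the Plücker coordinate $p_{ij}$ of the image, for all $i<j$. (ii) There is a homeomorphism $\widetilde T^3(d)\to X^*(d)$ that maps the class of $(\Psi(\kappa_1),\dots,\Psi(\kappa_d))$ to $R_1\wedge R_2$, where $R_1,R_2$ are the rows of the matrix with columns $\kappa_1,\dots,\kappa_d$. The complex lambda length from the $i$-th to the $j$-th spin-decorated horosphere is the Plücker coordinate $p_{ij}$ of the image, for all $i,j$. -/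

import Mathlib

open scoped MatrixGroups Matrix

noncomputable section

namespace SpinHoro

/-! ## Hyperbolic space, horospheres and the action of `SL(2)`

Minkowski space is the real vector space of Hermitian `2 × 2` matrices over `𝕜`, with
`(T, X, Y, Z)` written as `½ [[T + Z, X + iY], [X - iY, T - Z]]`. For `𝕜 = ℂ` this is
`ℝ^{1,3}`, whose hyperboloid is `ℍ³`; for `𝕜 = ℝ` it is the slice `Y = 0`, that is `ℝ^{1,2}`,
whose hyperboloid is the plane `ℍ² ⊂ ℍ³`. -/

section Minkowski

variable {𝕜 : Type} [RCLike 𝕜]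

/-- The Minkowski form `⟨S, S'⟩ = TT' - XX' - YY' - ZZ'`; on the diagonal it is `4 det S`. -/
def mink (S S' : Matrix (Fin 2) (Fin 2) 𝕜) : ℝ :=
  RCLike.re (2 * (S.trace * S'.trace - (S * S').trace))

/-- The action of a matrix on Minkowski space, `S ↦ A S A*`. -/
def act (A : SL(2, 𝕜)) (S : Matrix (Fin 2) (Fin 2) 𝕜) : Matrix (Fin 2) (Fin 2) 𝕜 :=
  A.1 * S * A.1ᴴ

lemma mink_eq_det (S S' : Matrix (Fin 2) (Fin 2) 𝕜) :
    mink S S' = RCLike.re (2 * ((S + S').det - S.det - S'.det)) := by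
  unfold mink
  congr 2
  simp [Matrix.det_fin_two, Matrix.trace_fin_two, Matrix.mul_apply, Fin.sum_univ_two]
  ring

lemma det_act (A : SL(2, 𝕜)) (S : Matrix (Fin 2) (Fin 2) 𝕜) : (act A S).det = S.det := by
  simp [act, Matrix.det_conjTranspose, A.2]

lemma act_add (A : SL(2, 𝕜)) (S S' : Matrix (Fin 2) (Fin 2) 𝕜) :
    act A (S + S') = act A S + act A S' := by
  simp [act, Matrix.mul_add, Matrix.add_mul]

lemma mink_act (A : SL(2, 𝕜)) (S S' : Matrix (Fin 2) (Fin 2) 𝕜) :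
    mink (act A S) (act A S') = mink S S' := by
  rw [mink_eq_det, mink_eq_det, ← act_add, det_act, det_act, det_act]

lemma act_one (S : Matrix (Fin 2) (Fin 2) 𝕜) : act 1 S = S := by
  simp [act]

lemma act_mul (A B : SL(2, 𝕜)) (S : Matrix (Fin 2) (Fin 2) 𝕜) :
    act (A * B) S = act A (act B S) := by
  simp [act, Matrix.conjTranspose_mul, Matrix.mul_assoc]

lemma act_isHermitian (A : SL(2, 𝕜)) {S : Matrix (Fin 2) (Fin 2) 𝕜} (hS : S.IsHermitian) :
    (act A S).IsHermitian :=
  Matrix.isHermitian_mul_mul_conjTranspose A.1 hS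

open scoped ComplexOrder in
lemma trace_act_pos (A : SL(2, 𝕜)) {S : Matrix (Fin 2) (Fin 2) 𝕜} (hS : S.IsHermitian)
    (hd : 0 ≤ mink S S) (ht : 0 < RCLike.re S.trace) : 0 < RCLike.re (act A S).trace := by
  have htr : S.trace = ((RCLike.re S.trace : ℝ) : 𝕜) := by
    have h : star S.trace = S.trace := by rw [← Matrix.trace_conjTranspose, hS.eq]
    exact (RCLike.conj_eq_iff_re.1 h).symm
  have hdet : S.det = ((RCLike.re S.det : ℝ) : 𝕜) := by
    have h : star S.det = S.det := by rw [← Matrix.det_conjTranspose, hS.eq]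
    exact (RCLike.conj_eq_iff_re.1 h).symm
  have hd' : 0 ≤ RCLike.re S.det := by
    have h : mink S S = 4 * RCLike.re S.det := by
      rw [mink_eq_det, show 2 * ((S + S).det - S.det - S.det) = ((4 : ℝ) : 𝕜) * S.det by
        rw [show ((4 : ℝ) : 𝕜) = 4 from RCLike.ofReal_ofNat 4]
        simp only [Matrix.det_fin_two, Matrix.add_apply]
        ring, RCLike.re_ofReal_mul]
    linarith
  have hCH : ((RCLike.re S.trace : ℝ) : 𝕜) • S =
      Sᴴ * S + ((RCLike.re S.det : ℝ) : 𝕜) • (1 : Matrix (Fin 2) (Fin 2) 𝕜) := by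
    rw [← htr, ← hdet, hS.eq]
    ext i j
    fin_cases i <;> fin_cases j <;>
      simp [Matrix.trace_fin_two, Matrix.det_fin_two, Matrix.mul_apply, Fin.sum_univ_two] <;> ring
  have hpsd : S.PosSemidef := by
    have h1 : (((RCLike.re S.trace : ℝ) : 𝕜) • S).PosSemidef := by
      rw [hCH]
      exact (Matrix.posSemidef_conjTranspose_mul_self S).add
        (Matrix.PosSemidef.one.smul (RCLike.ofReal_nonneg.2 hd'))
    have h2 := h1.smul (a := (((RCLike.re S.trace)⁻¹ : ℝ) : 𝕜))
      (RCLike.ofReal_nonneg.2 (inv_nonneg.2 ht.le))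
    rwa [smul_smul, ← RCLike.ofReal_mul, inv_mul_cancel₀ ht.ne', RCLike.ofReal_one,
      one_smul] at h2
  have hpsd' : (act A S).PosSemidef := hpsd.mul_mul_conjTranspose_same A.1
  have hn := hpsd'.trace_nonneg
  rcases hn.eq_or_lt with h0 | hpos
  · have hz : act A S = 0 := hpsd'.trace_eq_zero_iff.1 h0.symm
    have hS0 : S = 0 := by
      rw [← act_one S, ← inv_mul_cancel A, act_mul, hz]
      simp [act]
    simp [hS0] at ht
  · exact (RCLike.pos_iff.1 hpos).1

/-- The hyperboloid: hyperbolic 3-space for `𝕜 = ℂ`, the hyperbolic plane for `𝕜 = ℝ`. -/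
def Hyp (𝕜 : Type) [RCLike 𝕜] : Type :=
  {S : Matrix (Fin 2) (Fin 2) 𝕜 // S.IsHermitian ∧ mink S S = 1 ∧ 0 < RCLike.re S.trace}

/-- The future light cone `L⁺`. -/
def LightCone (𝕜 : Type) [RCLike 𝕜] : Type :=
  {S : Matrix (Fin 2) (Fin 2) 𝕜 // S.IsHermitian ∧ mink S S = 0 ∧ 0 < RCLike.re S.trace}

instance : TopologicalSpace (Hyp 𝕜) := instTopologicalSpaceSubtype

instance : TopologicalSpace (LightCone 𝕜) := instTopologicalSpaceSubtype

instance : MulAction SL(2, 𝕜) (Hyp 𝕜) where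
  smul A q := ⟨act A q.1, act_isHermitian A q.2.1, by rw [mink_act]; exact q.2.2.1,
    trace_act_pos A q.2.1 (by rw [q.2.2.1]; exact zero_le_one) q.2.2.2⟩
  one_smul q := Subtype.ext (act_one q.1)
  mul_smul A B q := Subtype.ext (act_mul A B q.1)

instance : MulAction SL(2, 𝕜) (LightCone 𝕜) where
  smul A p := ⟨act A p.1, act_isHermitian A p.2.1, by rw [mink_act]; exact p.2.2.1,
    trace_act_pos A p.2.1 p.2.2.1.ge p.2.2.2⟩
  one_smul p := Subtype.ext (act_one p.1)
  mul_smul A B p := Subtype.ext (act_mul A B p.1)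

lemma Hyp.coe_smul (A : SL(2, 𝕜)) (q : Hyp 𝕜) : (A • q).1 = act A q.1 := rfl

lemma LightCone.coe_smul (A : SL(2, 𝕜)) (p : LightCone 𝕜) : (A • p).1 = act A p.1 := rfl

/-- The horosphere (for `𝕜 = ℝ`, the horocycle) `{q | ⟨q, p⟩ = 1}` of a point `p` of the future
light cone. Distinct `p` give distinct horospheres, and every horosphere is of this form: below,
a horosphere or horocycle is given by its point `p`. -/
def horosphere (p : LightCone 𝕜) : Set (Hyp 𝕜) := {q | mink q.1 p.1 = 1}

lemma smul_mem_horosphere (A : SL(2, 𝕜)) {p : LightCone 𝕜} {q : Hyp 𝕜}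
    (hq : q ∈ horosphere p) : A • q ∈ horosphere (A • p) := by
  change mink (A • q).1 (A • p).1 = 1
  rw [Hyp.coe_smul, LightCone.coe_smul, mink_act]
  exact hq

lemma inv_smul_mem_horosphere (A : SL(2, 𝕜)) {p : LightCone 𝕜} {q : Hyp 𝕜}
    (hq : q ∈ horosphere (A • p)) : A⁻¹ • q ∈ horosphere p := by
  simpa using smul_mem_horosphere A⁻¹ hq

/-- The outward unit normal (towards the centre) at a point `q` of the horosphere of `p`. -/
def outwardNormal (p : LightCone 𝕜) (q : Hyp 𝕜) : Matrix (Fin 2) (Fin 2) 𝕜 := p.1 - q.1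

/-- The inward unit normal (away from the centre) at a point `q` of the horosphere of `p`. -/
def inwardNormal (p : LightCone 𝕜) (q : Hyp 𝕜) : Matrix (Fin 2) (Fin 2) 𝕜 := q.1 - p.1

/-- The geodesic joining the points at infinity of `p₁` and `p₂` (which are distinct in all uses):
the intersection of the hyperboloid with the plane spanned by `p₁` and `p₂`. -/
def geodesic (p₁ p₂ : LightCone 𝕜) : Set (Hyp 𝕜) :=
  {q | ∃ a b : ℝ, q.1 = a • p₁.1 + b • p₂.1}

/-- Nonzero spinors (for `𝕜 = ℝ`, nonzero real spinors). -/
def Spinor (𝕜 : Type) [RCLike 𝕜] : Type := {κ : Fin 2 → 𝕜 // κ ≠ 0}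

instance : TopologicalSpace (Spinor 𝕜) := instTopologicalSpaceSubtype

instance : MulAction SL(2, 𝕜) (Spinor 𝕜) where
  smul A κ := ⟨A • κ.1, (smul_ne_zero_iff_ne A).2 κ.2⟩
  one_smul κ := Subtype.ext (one_smul _ κ.1)
  mul_smul A B κ := Subtype.ext (mul_smul A B κ.1)

/-- The symplectic form `{κ, κ'} = ξη' - ηξ'`. -/
def symp (κ κ' : Spinor 𝕜) : 𝕜 := κ.1 0 * κ'.1 1 - κ.1 1 * κ'.1 0

/-- The `2 × d` matrix whose columns are the given spinors. -/
def spinorMatrix {d : ℕ} (κ : Fin d → Spinor 𝕜) : Matrix (Fin 2) (Fin d) 𝕜 :=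
  Matrix.of fun a i => (κ i).1 a

end Minkowski

/-- A real spinor as a complex one. -/
def Spinor.ofReal (κ : Spinor ℝ) : Spinor ℂ :=
  ⟨fun a => (κ.1 a : ℂ), fun h => κ.2 (funext fun a => by simpa using congrFun h a)⟩

/-- The centre, in `∂ℍ³ = ℂ ∪ {∞}`, of the horosphere of `p`; it is `(X + iY) / (T - Z)`. -/
def centre (p : LightCone ℂ) : OnePoint ℂ :=
  if p.1 1 1 = 0 then OnePoint.infty else ((p.1 0 1 / p.1 1 1 : ℂ) : OnePoint ℂ)

/-- The centre, in `∂ℍ² = ℝ ∪ {∞}`, of the horocycle of `p`. The boundary is written as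
`WithTop ℝ`, so that `∞` is larger than every real number. -/
def centreReal (p : LightCone ℝ) : WithTop ℝ :=
  if p.1 1 1 = 0 then ⊤ else ((p.1 0 1 / p.1 1 1 : ℝ) : WithTop ℝ)

/-! ## Spin frames -/

/-- Spin frames. The group `PSL(2, ℂ)` acts simply transitively on the right-handed orthonormal
frames of `ℍ³`, and `SL(2, ℂ)` acts simply transitively on the spin double cover of the frame
bundle; with a base spin frame fixed, a spin frame is thus an element `A` of `SL(2, ℂ)`, lying over
the frame `A • (∂_Z, ∂_Y, -∂_X)` at the point `A • (1, 0, 0, 0)`. The vectors `f₁`, `f₂` of this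
frame are `vec₁`, `vec₂` below, and `f₃ = f₁ × f₂` is determined by them. Spin isometries act by
left multiplication. -/
abbrev SpinFrame : Type := SL(2, ℂ)

namespace SpinFrame

/-- The base point of a spin frame. -/
def pt (A : SpinFrame) : Matrix (Fin 2) (Fin 2) ℂ := act A ((1 / 2 : ℂ) • 1)

/-- The first vector of the frame under a spin frame. -/
def vec₁ (A : SpinFrame) : Matrix (Fin 2) (Fin 2) ℂ := act A ((1 / 2 : ℂ) • !![1, 0; 0, -1])

/-- The second vector of the frame under a spin frame. -/
def vec₂ (A : SpinFrame) : Matrix (Fin 2) (Fin 2) ℂ :=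
  act A ((1 / 2 : ℂ) • !![0, Complex.I; -Complex.I, 0])

/-- The spin frame obtained from `A` by translating it by the signed distance `ρ` along the
geodesic directed by its first vector. -/
def translate (ρ : ℝ) (A : SpinFrame) : SpinFrame :=
  A * ⟨!![(Real.exp (ρ / 2) : ℂ), 0; 0, (Real.exp (-(ρ / 2)) : ℂ)], by
    rw [Matrix.det_fin_two_of, ← Complex.ofReal_mul, ← Real.exp_add]; simp⟩

/-- The spin frame obtained from `A` by rotating it by the angle `θ` about its first vector. -/
def rotate₁ (θ : ℝ) (A : SpinFrame) : SpinFrame :=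
  A * ⟨!![Complex.exp (θ / 2 * Complex.I), 0; 0, Complex.exp (-(θ / 2 * Complex.I))], by
    rw [Matrix.det_fin_two_of, ← Complex.exp_add]; simp⟩

/-- The spin frame obtained from `A` by rotating it by the angle `θ` about its second vector. -/
def rotate₂ (θ : ℝ) (A : SpinFrame) : SpinFrame :=
  A * ⟨!![(Real.cos (θ / 2) : ℂ), -(Real.sin (θ / 2) : ℂ);
      (Real.sin (θ / 2) : ℂ), (Real.cos (θ / 2) : ℂ)], by
    rw [Matrix.det_fin_two_of, neg_mul, sub_neg_eq_add, ← sq, ← sq]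
    exact_mod_cast Real.cos_sq_add_sin_sq (θ / 2)⟩

lemma pt_mul (A B : SpinFrame) : pt (A * B) = act A (pt B) := act_mul A B _

lemma vec₁_mul (A B : SpinFrame) : vec₁ (A * B) = act A (vec₁ B) := act_mul A B _

lemma vec₂_mul (A B : SpinFrame) : vec₂ (A * B) = act A (vec₂ B) := act_mul A B _

end SpinFrame

/-! ## Spin-decorated horospheres -/

/-- A tangent vector field on the horosphere of `p` is parallel if it is invariant under all
parabolic isometries that preserve the horosphere. -/
def IsParallel (p : LightCone ℂ) (v : horosphere p → Matrix (Fin 2) (Fin 2) ℂ) : Prop :=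
  ∀ M : SL(2, ℂ), M.1.IsParabolic → M • p = p →
    ∀ q q' : horosphere p, q'.1 = M • q.1 → v q' = act M (v q)

lemma isParabolic_conj (A : SL(2, ℂ)) {M : SL(2, ℂ)} (hM : M.1.IsParabolic) :
    (A⁻¹ * M * A).1.IsParabolic := by
  have h1 : A.1 * A⁻¹.1 = 1 := by
    rw [← Matrix.SpecialLinearGroup.coe_mul, mul_inv_cancel, Matrix.SpecialLinearGroup.coe_one]
  have h2 : A⁻¹.1 * A.1 = 1 := by
    rw [← Matrix.SpecialLinearGroup.coe_mul, inv_mul_cancel, Matrix.SpecialLinearGroup.coe_one]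
  have h := (Matrix.isParabolic_conj_iff (m := M.1) (⟨A⁻¹.1, A.1, h2, h1⟩ : GL (Fin 2) ℂ)).2 hM
  rw [← Matrix.coe_units_inv] at h
  exact h

/-- A spin-decorated horosphere: the horosphere of `p`, with a continuous lift `wout` to spin
frames of the outward frame field `(N, v, N × v)` of a unit parallel tangent vector field `v`, where
`N` is the outward normal. (That `v` is of length one and tangent to the horosphere is part of
being the second vector of a frame whose first vector is `N`.) This is the outward spin decoration
`W^out`; the associated inward one, `W^in`, is determined by it, and is `win` below. -/
structure SpinDecoratedHorosphere where
  p : LightCone ℂ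
  wout : horosphere p → SpinFrame
  continuous_wout : Continuous wout
  pt_wout : ∀ q, (wout q).pt = q.1.1
  vec₁_wout : ∀ q, (wout q).vec₁ = outwardNormal p q.1
  parallel : IsParallel p fun q => (wout q).vec₂

namespace SpinDecoratedHorosphere

/-- The decoration: the unit parallel tangent vector field under a spin decoration. -/
def decoration (W : SpinDecoratedHorosphere) (q : horosphere W.p) : Matrix (Fin 2) (Fin 2) ℂ :=
  (W.wout q).vec₂

/-- The associated inward spin decoration: rotate the outward one by `π` about the decoration. -/
def win (W : SpinDecoratedHorosphere) (q : horosphere W.p) : SpinFrame :=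
  (W.wout q).rotate₂ Real.pi

/-- Spin isometries act on spin-decorated horospheres, by `(A • W)(q) = A • W(A⁻¹ • q)`. -/
instance : SMul SL(2, ℂ) SpinDecoratedHorosphere where
  smul A W :=
    { p := A • W.p
      wout := fun q => A * W.wout ⟨A⁻¹ • q.1, inv_smul_mem_horosphere A q.2⟩
      continuous_wout := by
        refine continuous_const.mul (W.continuous_wout.comp ?_)
        refine Continuous.subtype_mk ?_ _
        refine Continuous.subtype_mk (f := fun q : horosphere (A • W.p) => act A⁻¹ q.1.1) ?_ _
        have h : Continuous fun q : horosphere (A • W.p) => q.1.1 :=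
          continuous_subtype_val.comp continuous_subtype_val
        exact (continuous_const.matrix_mul h).matrix_mul continuous_const
      pt_wout := fun q => by
        rw [SpinFrame.pt_mul, W.pt_wout, Hyp.coe_smul, ← act_mul, mul_inv_cancel, act_one]
      vec₁_wout := fun q => by
        rw [SpinFrame.vec₁_mul, W.vec₁_wout]
        simp only [outwardNormal, Hyp.coe_smul, LightCone.coe_smul, sub_eq_add_neg, act_add]
        congr 1
        have h : ∀ S : Matrix (Fin 2) (Fin 2) ℂ, act A (-S) = -act A S := fun S => by simp [act]
        rw [h, ← act_mul, mul_inv_cancel, act_one]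
      parallel := fun M hM hp q q' hq => by
        have hp' : (A⁻¹ * M * A) • W.p = W.p := by
          rw [mul_smul, mul_smul, hp, inv_smul_smul]
        have h := W.parallel (A⁻¹ * M * A) (isParabolic_conj A hM) hp'
          ⟨A⁻¹ • q.1, inv_smul_mem_horosphere A q.2⟩
          ⟨A⁻¹ • q'.1, inv_smul_mem_horosphere A q'.2⟩ (by
            simp only [hq, mul_smul, smul_inv_smul])
        simp only [SpinFrame.vec₂_mul] at h ⊢
        rw [h, ← act_mul, ← act_mul]
        congr 1
        group }

lemma smul_p (A : SL(2, ℂ)) (W : SpinDecoratedHorosphere) : (A • W).p = A • W.p := rfl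

lemma smul_wout (A : SL(2, ℂ)) (W : SpinDecoratedHorosphere) (q : horosphere (A • W).p) :
    (A • W).wout q = A * W.wout ⟨A⁻¹ • q.1, inv_smul_mem_horosphere A q.2⟩ := rfl

lemma ext' {W W' : SpinDecoratedHorosphere} (hp : W.p = W'.p)
    (hw : ∀ q (h : q ∈ horosphere W.p) (h' : q ∈ horosphere W'.p),
      W.wout ⟨q, h⟩ = W'.wout ⟨q, h'⟩) : W = W' := by
  obtain ⟨p, w, _, _, _, _⟩ := W
  obtain ⟨p', w', _, _, _, _⟩ := W'
  obtain rfl : p = p' := hp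
  obtain rfl : w = w' := funext fun q => hw q.1 q.2 q.2
  rfl

instance : MulAction SL(2, ℂ) SpinDecoratedHorosphere where
  one_smul W := ext' (one_smul _ W.p) fun q h h' => by
    rw [smul_wout, one_mul]
    congr 2
    simp
  mul_smul A B W := ext' (mul_smul A B W.p) fun q h h' => by
    rw [smul_wout, smul_wout, smul_wout, mul_assoc]
    congr 4
    simp [mul_smul]

/-- The topology of the space of spin-decorated horospheres as a homogeneous space: the finest
topology for which all orbit maps of the (transitive) action of `SL(2, ℂ)` are continuous. -/
instance : TopologicalSpace SpinDecoratedHorosphere :=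
  ⨆ W : SpinDecoratedHorosphere,
    TopologicalSpace.coinduced (fun A : SL(2, ℂ) => A • W) inferInstance

end SpinDecoratedHorosphere

/-! ## Lambda lengths -/

/-- `d` is a complex distance from the spin frame `A` to the spin frame `B` (adapted to a common
oriented geodesic): for `d = ρ + iθ`, the spin frame `B` is obtained from `A` by a translation of
signed distance `ρ` along the geodesic, followed by a rotation by `θ` about it. -/
def IsComplexDistance (A B : SpinFrame) (d : ℂ) : Prop :=
  B = (A.translate d.re).rotate₁ d.im

/-- `l` is the complex lambda length from `W₁` to `W₂`: it is `0` if the centres agree, and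
otherwise `exp (d / 2)`, for `d` the complex distance from `W₁^in` to `W₂^out` at the points where
the geodesic joining the centres meets the two horospheres. -/
def IsComplexLambdaLength (W₁ W₂ : SpinDecoratedHorosphere) (l : ℂ) : Prop :=
  (centre W₁.p = centre W₂.p ∧ l = 0) ∨
  (centre W₁.p ≠ centre W₂.p ∧ ∃ (q₁ : horosphere W₁.p) (q₂ : horosphere W₂.p) (d : ℂ),
    q₁.1 ∈ geodesic W₁.p W₂.p ∧ q₂.1 ∈ geodesic W₁.p W₂.p ∧
    IsComplexDistance (W₁.win q₁) (W₂.wout q₂) d ∧ l = Complex.exp (d / 2))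

/-- `l` is the lambda length `exp (ρ / 2)` between the horocycles of `h₁` and `h₂` in `ℍ²` (with
distinct centres), where `ρ` is the signed distance from the first horocycle to the second along
the geodesic from the first centre to the second. The unit tangent vector of this oriented geodesic
where it meets the first horocycle is the inward normal of that horocycle. -/
def IsRealLambdaLength (h₁ h₂ : LightCone ℝ) (l : ℝ) : Prop :=
  ∃ (q₁ : horosphere h₁) (q₂ : horosphere h₂) (ρ : ℝ),
    q₁.1 ∈ geodesic h₁ h₂ ∧ q₂.1 ∈ geodesic h₁ h₂ ∧
    q₂.1.1 = Real.cosh ρ • q₁.1.1 + Real.sinh ρ • inwardNormal h₁ q₁.1 ∧ l = Real.exp (ρ / 2)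

/-! ## The correspondence between spinors and spin-decorated horospheres -/

/-- The derivative of `κ ↦ κ κ*` at `κ` in the direction `ν`, namely `κ ν* + ν κ*`. -/
def dphi (κ ν : Fin 2 → ℂ) : Matrix (Fin 2) (Fin 2) ℂ :=
  Matrix.vecMulVec κ (star ν) + Matrix.vecMulVec ν (star κ)

/-- `Z(ξ, η) = (i η̄, -i ξ̄)`. -/
def zdir (κ : Fin 2 → ℂ) : Fin 2 → ℂ :=
  ![Complex.I * star (κ 1), -Complex.I * star (κ 0)]

/-- `W` lies over the decorated horosphere of the null flag of the spinor `κ`. The flag has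
flagpole `p = κ κ*` and flag plane spanned by `p` and `v₀ = D_κ(κ κ*)(Z κ)`, oriented by `v₀` modulo
`p`; the horosphere is that of `p`, and its decoration at each point lies in the flag plane, on the
positive side. -/
def LiesOver (W : SpinDecoratedHorosphere) (κ : Spinor ℂ) : Prop :=
  W.p.1 = Matrix.vecMulVec κ.1 (star κ.1) ∧
  ∀ q : horosphere W.p, ∃ a b : ℝ, 0 < b ∧
    W.decoration q = a • W.p.1 + b • dphi κ.1 (zdir κ.1)

/-- The correspondence between nonzero spinors and spin-decorated horospheres: an
`SL(2, ℂ)`-equivariant homeomorphism that lifts the map from spinors to decorated horospheres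
through null flags. (It is unique up to composition with `κ ↦ -κ`.) -/
def IsSpinorCorrespondence (Ψ : Spinor ℂ ≃ₜ SpinDecoratedHorosphere) : Prop :=
  (∀ (A : SL(2, ℂ)) (κ : Spinor ℂ), Ψ (A • κ) = A • Ψ κ) ∧ ∀ κ, LiesOver (Ψ κ) κ

/-- `W` is a planar spin decoration of the horocycle of `h` in `ℍ² ⊂ ℍ³`: its horosphere extends
the horocycle, and along the horocycle its decoration is the unit normal `∂_Y` to `ℍ²`, pointing in
the direction `i` in the upper half space model. -/
def IsPlanar (h : LightCone ℝ) (W : SpinDecoratedHorosphere) : Prop :=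
  W.p.1 = h.1.map Complex.ofReal ∧
  ∀ q : horosphere W.p, (∃ S : Matrix (Fin 2) (Fin 2) ℝ, q.1.1 = S.map Complex.ofReal) →
    W.decoration q = (1 / 2 : ℂ) • !![0, Complex.I; -Complex.I, 0]

/-! ## Decorated Teichmüller spaces -/

/-- Decorated ideal `d`-gons: horocycles in `ℍ²` whose centres are distinct and in order around
`∂ℍ² = ℝ ∪ {∞}` in the negative direction, which means that some cyclic rotation of the sequence of
centres is strictly decreasing in `ℝ ∪ {∞}` with `∞` largest. (The vertices are the centres.) -/
def DecoratedPolygon (d : ℕ) : Type :=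
  {h : Fin d → LightCone ℝ //
    ∃ k : ℕ, StrictAnti fun i : Fin d => centreReal (h ((finRotate d ^ k) i))}

instance (d : ℕ) : TopologicalSpace (DecoratedPolygon d) := instTopologicalSpaceSubtype

/-- Decorated ideal `d`-gons up to orientation-preserving isometries of `ℍ²`: these are given by
`SL(2, ℝ)`, acting through `PSL(2, ℝ)`. -/
instance DecoratedPolygon.setoid (d : ℕ) : Setoid (DecoratedPolygon d) :=
  (MulAction.orbitRel SL(2, ℝ) (Fin d → LightCone ℝ)).comap Subtype.val

/-- The decorated Teichmüller space of ideal `d`-gons. -/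
def Teich (d : ℕ) : Type := Quotient (DecoratedPolygon.setoid d)

instance (d : ℕ) : TopologicalSpace (Teich d) := instTopologicalSpaceQuotient

/-- The class of a decorated ideal polygon. -/
def Teich.mk {d : ℕ} (G : DecoratedPolygon d) : Teich d := Quotient.mk _ G

/-- Spin-decorated skew ideal `d`-gons: spin-decorated horospheres in `ℍ³` with distinct centres.
(The vertices are the centres.) -/
def SpinPolygon (d : ℕ) : Type :=
  {W : Fin d → SpinDecoratedHorosphere // Function.Injective fun i => centre (W i).p}

instance (d : ℕ) : TopologicalSpace (SpinPolygon d) := instTopologicalSpaceSubtype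

/-- Spin-decorated skew ideal `d`-gons up to spin isometries of `ℍ³`. -/
instance SpinPolygon.setoid (d : ℕ) : Setoid (SpinPolygon d) :=
  (MulAction.orbitRel SL(2, ℂ) (Fin d → SpinDecoratedHorosphere)).comap Subtype.val

/-- The decorated Teichmüller space of spin-decorated skew ideal `d`-gons. -/
def Teich3 (d : ℕ) : Type := Quotient (SpinPolygon.setoid d)

instance (d : ℕ) : TopologicalSpace (Teich3 d) := instTopologicalSpaceQuotient

/-- The class of a spin-decorated skew ideal polygon. -/
def Teich3.mk {d : ℕ} (G : SpinPolygon d) : Teich3 d := Quotient.mk _ G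

/-! ## Grassmannians of 2-planes and their affine cones -/

section Grassmannian

variable {𝕜 : Type} [RCLike 𝕜] {d : ℕ}

/-- The `2 × 2` minor of a `2 × d` matrix on the columns `i` and `j`. -/
def minor (M : Matrix (Fin 2) (Fin d) 𝕜) (i j : Fin d) : 𝕜 := (M.submatrix id ![i, j]).det

/-- The Plücker coordinate `p_{ij}` on `Λ²(𝕜^d)`: the linear form with
`p_{ij}(u ∧ v) = u_i v_j - u_j v_i`. -/
def plucker (i j : Fin d) : ⋀[𝕜]^2 (Fin d → 𝕜) →ₗ[𝕜] 𝕜 :=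
  exteriorPower.alternatingMapLinearEquiv
    ((Matrix.detRowAlternating (n := Fin 2) (R := 𝕜)).compLinearMap
      (LinearMap.funLeft 𝕜 𝕜 ![i, j]))

/-- The element `R₁ ∧ R₂` of `Λ²(𝕜^d)`, for `R₁` and `R₂` the rows of a `2 × d` matrix. -/
def rowWedge (M : Matrix (Fin 2) (Fin d) 𝕜) : ⋀[𝕜]^2 (Fin d → 𝕜) :=
  exteriorPower.ιMulti 𝕜 2 M.row

/-- The topology of the finite-dimensional space `Λ²(𝕜^d)`, given by the Plücker coordinates. -/
instance : TopologicalSpace (⋀[𝕜]^2 (Fin d → 𝕜)) :=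
  TopologicalSpace.induced (fun ω => fun i j : Fin d => plucker i j ω) inferInstance

/-- The affine cone (without its vertex) on a set of 2-planes in `𝕜^d`: the nonzero decomposable
elements of `Λ²(𝕜^d)` that represent a plane of the set. -/
def affineCone (P : Set (Submodule 𝕜 (Fin d → 𝕜))) : Set (⋀[𝕜]^2 (Fin d → 𝕜)) :=
  {ω | ∃ M : Matrix (Fin 2) (Fin d) 𝕜, LinearIndependent 𝕜 M.row ∧
    Submodule.span 𝕜 (Set.range M.row) ∈ P ∧ ω = rowWedge M}

variable (d)

/-- The positive Grassmannian `Gr⁺(2, d)`: row spaces of real `2 × d` matrices all of whose minors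
on columns `i < j` are positive. -/
def positiveGrassmannian : Set (Submodule ℝ (Fin d → ℝ)) :=
  {V | ∃ M : Matrix (Fin 2) (Fin d) ℝ, (∀ i j, i < j → 0 < minor M i j) ∧
    V = Submodule.span ℝ (Set.range M.row)}

/-- The positive affine Grassmannian `X⁺(d)`, the affine cone on `Gr⁺(2, d)`. As `Gr⁺(2, d)` is a
quotient by `GL⁺(2, ℝ)`, only the elements with positive coordinates, and not their negatives,
belong to the cone. -/
def XPos : Type :=
  {ω : ⋀[ℝ]^2 (Fin d → ℝ) //
    ω ∈ affineCone (positiveGrassmannian d) ∧ ∀ i j, i < j → 0 < plucker i j ω}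

/-- The part of the complex Grassmannian `Gr(2, d)` where all Plücker coordinates are nonzero. -/
def nonzeroGrassmannian : Set (Submodule ℂ (Fin d → ℂ)) :=
  {V | ∃ M : Matrix (Fin 2) (Fin d) ℂ, (∀ i j, i < j → minor M i j ≠ 0) ∧
    V = Submodule.span ℂ (Set.range M.row)}

/-- The nonzero affine Grassmannian `X*(d)`, the affine cone on that part. -/
def XNonzero : Type :=
  {ω : ⋀[ℂ]^2 (Fin d → ℂ) // ω ∈ affineCone (nonzeroGrassmannian d)}

instance : TopologicalSpace (XPos d) := instTopologicalSpaceSubtype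

instance : TopologicalSpace (XNonzero d) := instTopologicalSpaceSubtype

end Grassmannian

/-- A tuple of real spinors is totally positive if `{κ_i, κ_j} > 0` for all `i < j`. -/
def IsTotallyPositive {d : ℕ} (κ : Fin d → Spinor ℝ) : Prop :=
  ∀ i j, i < j → 0 < symp (κ i) (κ j)

end SpinHoro

end

/-! A spin-decorated horosphere carries the same information as the first column of any of its
outward spin frames. If `A` is in SL(2,ℂ), then `pt + vec₁` is `A e₁e₁* A*`, that is `κκ*` for the
first column `κ` of `A`. For an outward frame, point plus normal is `p`, so `p = κκ*`. The frames
with a fixed first column form a coset of the group of parabolic translations `unip z`, and their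
base points sweep out the horosphere once. Parallelism of the decoration transports a frame along
the horosphere up to sign, and continuity on the connected parameter plane ℂ fixes the sign
(`eq_std`). Hence both spaces are the homogeneous space of SL(2,ℂ) by the stabiliser of `(1, 0)`,
and "first column" is the required equivariant homeomorphism.

Lambda lengths become determinants. Passing from the outward to the inward frame turns the columns
`(c₁, c₂)` into `(c₂, -c₁)`, and a complex translation by `d` multiplies the first column by `exp
(d/2)`. So the second spinor is `κ' = exp (d/2) c₂`, and `det (κ, c₂) = 1` gives `{κ, κ'} = exp
(d/2)` (`isComplexLambdaLength_iff`). Centres agree exactly when the form vanishes.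

The form values `{κ_i, κ_j}` are the Plücker coordinates of `R₁ ∧ R₂`, which SL(2) preserves.
Conversely, once one coordinate `p_ab` is nonzero, the tuple can be moved by SL(2) to a normal form
written continuously in Plücker coordinates (`exists_smul_eq_normalColumn`). This gives a continuous
inverse, hence (ii).

For (i), a horocycle determines a real spinor only up to sign. The cyclic order of the centres is
exactly what makes a simultaneous choice of signs with all `{κ_i, κ_j} > 0`, `i < j`, possible. For
such a lift `{κ_i, κ_j}` is the positive root of half the Minkowski product of the two light cone
points, so the wedge is independent of the lift and continuous, and the normal form again gives the
inverse. -/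

noncomputable section

namespace SpinHoro

open scoped ComplexConjugate

/-! ## Spin frames and their first columns -/

/-- The spinor `(1, 0)`. -/
def Spinor.std : Spinor ℂ := ⟨![1, 0], fun h => one_ne_zero (congrFun h 0)⟩

lemma Spinor.std_zero : Spinor.std.1 0 = 1 := rfl

lemma Spinor.std_one : Spinor.std.1 1 = 0 := rfl

lemma Spinor.coe_smul {𝕜 : Type} [RCLike 𝕜] (A : SL(2, 𝕜)) (κ : Spinor 𝕜) :
    (A • κ).1 = A.1 *ᵥ κ.1 := rfl

lemma Spinor.smul_std_apply (A : SL(2, ℂ)) (i : Fin 2) : (A • Spinor.std).1 i = A.1 i 0 := by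
  rw [Spinor.coe_smul]
  simp [Spinor.std, Matrix.mulVec, dotProduct, Fin.sum_univ_two]

lemma act_neg {𝕜 : Type} [RCLike 𝕜] (A : SL(2, 𝕜)) (S : Matrix (Fin 2) (Fin 2) 𝕜) :
    act (-A) S = act A S := by
  simp [act]

lemma act_vecMulVec {𝕜 : Type} [RCLike 𝕜] (A : SL(2, 𝕜)) (κ ν : Fin 2 → 𝕜) :
    act A (Matrix.vecMulVec κ (star ν)) =
      Matrix.vecMulVec (A.1 *ᵥ κ) (star (A.1 *ᵥ ν)) := by
  rw [act, Matrix.mul_vecMulVec, Matrix.vecMulVec_mul, Matrix.star_mulVec]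

/-- At the base frame, point and first vector add up to the projection onto `(1, 0)`. This identity
is what lets the first column determine the horosphere. -/
lemma SpinFrame.pt_add_vec₁ (A : SpinFrame) :
    A.pt + A.vec₁ = Matrix.vecMulVec (A • Spinor.std).1 (star (A • Spinor.std).1) := by
  rw [SpinFrame.pt, SpinFrame.vec₁, ← act_add, Spinor.coe_smul, ← act_vecMulVec]
  congr 1
  ext i j
  fin_cases i <;> fin_cases j <;> (simp [Spinor.std, Matrix.vecMulVec_apply]; try norm_num)

lemma SpinFrame.pt_apply (A : SpinFrame) (i j : Fin 2) :
    A.pt i j = (A.1 i 0 * conj (A.1 j 0) + A.1 i 1 * conj (A.1 j 1)) / 2 := by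
  simp [SpinFrame.pt, act, Matrix.mul_apply, Fin.sum_univ_two]
  ring

lemma SpinFrame.vec₂_apply (A : SpinFrame) (i j : Fin 2) :
    A.vec₂ i j =
      Complex.I * (A.1 i 0 * conj (A.1 j 1) - A.1 i 1 * conj (A.1 j 0)) / 2 := by
  simp [SpinFrame.vec₂, act, Matrix.mul_apply, Fin.sum_univ_two]
  ring

lemma SpinFrame.vec₁_apply (A : SpinFrame) (i j : Fin 2) :
    A.vec₁ i j = (A.1 i 0 * conj (A.1 j 0) - A.1 i 1 * conj (A.1 j 1)) / 2 := by
  simp [SpinFrame.vec₁, act, Matrix.mul_apply, Fin.sum_univ_two]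
  ring

lemma SpinFrame.isHermitian_pt (A : SpinFrame) : A.pt.IsHermitian := by
  refine act_isHermitian A ?_
  ext i j
  fin_cases i <;> fin_cases j <;> simp

lemma mink_half_one : mink ((1 / 2 : ℂ) • (1 : Matrix (Fin 2) (Fin 2) ℂ)) ((1 / 2 : ℂ) • 1) = 1 := by
  simp [mink]
  norm_num

/-- The base point of a spin frame, as a point of `ℍ³`. -/
def SpinFrame.ptHyp (A : SpinFrame) : Hyp ℂ :=
  ⟨A.pt, A.isHermitian_pt, by rw [SpinFrame.pt, mink_act, mink_half_one], by
    refine trace_act_pos A ?_ ?_ ?_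
    · ext i j
      fin_cases i <;> fin_cases j <;> simp
    · rw [mink_half_one]; exact zero_le_one
    · simp⟩

/-- A spin frame is determined up to sign by its frame. -/
lemma SpinFrame.diagonal_of_frame_eq_one {C : SpinFrame} (h0 : C.pt = SpinFrame.pt 1)
    (h1 : C.vec₁ = SpinFrame.vec₁ 1) (h2 : C.vec₂ = SpinFrame.vec₂ 1) :
    C.1 0 0 ^ 2 = 1 ∧ C.1 0 1 = 0 ∧ C.1 1 0 = 0 ∧ C.1 1 1 = C.1 0 0 := by
  have hp := fun i j => congrFun (congrFun h0 i) j
  have hv := fun i j => congrFun (congrFun h1 i) j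
  have hw := fun i j => congrFun (congrFun h2 i) j
  simp only [SpinFrame.pt_apply, SpinFrame.vec₁_apply, SpinFrame.vec₂_apply] at hp hv hw
  have e00 := hp 0 0
  have e11 := hp 1 1
  have f00 := hv 0 0
  have f11 := hv 1 1
  have g01 := hw 0 1
  simp only [Matrix.SpecialLinearGroup.coe_one, Matrix.one_apply_eq, ne_eq, zero_ne_one,
    not_false_eq_true, Matrix.one_apply_ne, one_ne_zero, map_one, map_zero, mul_one, mul_zero,
    add_zero, sub_zero, zero_add, zero_sub] at e00 e11 f00 f11 g01
  -- `pt - vec₁` and `pt + vec₁` are the rank-one forms of the second and the first column, so the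
  -- off-diagonal entries have modulus zero. The vector `vec₂` then ties the phases of the diagonal
  -- entries together.
  have hb : C.1 0 1 = 0 := by
    have : C.1 0 1 * conj (C.1 0 1) = 0 := by linear_combination e00 - f00
    simpa [Complex.mul_conj] using this
  have hc : C.1 1 0 = 0 := by
    have : C.1 1 0 * conj (C.1 1 0) = 0 := by linear_combination e11 + f11
    simpa [Complex.mul_conj] using this
  have hd : C.1 1 1 * conj (C.1 1 1) = 1 := by linear_combination e11 - f11
  have ha : C.1 0 0 * conj (C.1 1 1) = 1 := by
    rw [hb, zero_mul, sub_zero] at g01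
    have h3 : Complex.I * (C.1 0 0 * conj (C.1 1 1) - 1) = 0 := by linear_combination 2 * g01
    rcases mul_eq_zero.1 h3 with h | h
    · exact absurd h Complex.I_ne_zero
    · exact sub_eq_zero.1 h
  have hne : conj (C.1 1 1) ≠ 0 := right_ne_zero_of_mul_eq_one ha
  have hda : C.1 1 1 = C.1 0 0 := mul_right_cancel₀ hne (hd.trans ha.symm)
  have hdet := C.2
  rw [Matrix.det_fin_two, hb, hda] at hdet
  exact ⟨by linear_combination hdet, hb, hc, hda⟩

/-! ## The standard spin-decorated horosphere -/

/-- The parabolic translation by `z`. -/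
def unip (z : ℂ) : SL(2, ℂ) := ⟨!![1, z; 0, 1], by simp⟩

lemma unip_coe (z : ℂ) : (unip z).1 = !![1, z; 0, 1] := rfl

lemma unip_mul (z w : ℂ) : unip z * unip w = unip (w + z) := by
  ext i j
  rw [Matrix.SpecialLinearGroup.coe_mul]
  fin_cases i <;> fin_cases j <;> simp [unip_coe]

lemma unip_zero : unip 0 = 1 := by
  ext i j
  fin_cases i <;> fin_cases j <;> simp [unip_coe]

lemma unip_smul_std (z : ℂ) : unip z • Spinor.std = Spinor.std := by
  refine Subtype.ext (funext fun i => ?_)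
  rw [Spinor.smul_std_apply]
  fin_cases i <;> simp [unip_coe, Spinor.std]

lemma eq_unip_of_smul_std {A : SL(2, ℂ)} (h : A • Spinor.std = Spinor.std) :
    A = unip (A.1 0 1) := by
  have h0 : A.1 0 0 = 1 := by rw [← Spinor.smul_std_apply, h]; rfl
  have h1 : A.1 1 0 = 0 := by rw [← Spinor.smul_std_apply, h]; rfl
  have hd := A.2
  rw [Matrix.det_fin_two, h0, h1] at hd
  ext i j
  fin_cases i <;> fin_cases j
  · exact h0
  · rfl
  · exact h1
  · change A.1 1 1 = 1
    linear_combination hd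

lemma continuous_unip : Continuous unip := by
  refine Continuous.subtype_mk (continuous_matrix fun i j => ?_) _
  fin_cases i <;> fin_cases j <;> simp <;> fun_prop

/-- The point of the light cone of the spinor `κ`, namely `κ κ*`. -/
def Spinor.flagpole {𝕜 : Type} [RCLike 𝕜] (κ : Spinor 𝕜) : LightCone 𝕜 :=
  ⟨Matrix.vecMulVec κ.1 (star κ.1), by
    rw [Matrix.IsHermitian, Matrix.conjTranspose_vecMulVec, star_star], by
    have h : Matrix.trace (Matrix.vecMulVec κ.1 (star κ.1)) *
        Matrix.trace (Matrix.vecMulVec κ.1 (star κ.1)) -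
        Matrix.trace (Matrix.vecMulVec κ.1 (star κ.1) * Matrix.vecMulVec κ.1 (star κ.1)) = 0 := by
      simp only [Matrix.trace_fin_two, Matrix.mul_apply, Matrix.vecMulVec_apply, Fin.sum_univ_two]
      ring
    rw [mink, h, mul_zero, map_zero], by
    have h : RCLike.re (Matrix.vecMulVec κ.1 (star κ.1)).trace =
        RCLike.normSq (κ.1 0) + RCLike.normSq (κ.1 1) := by
      simp only [Matrix.trace_fin_two, Matrix.vecMulVec_apply, Pi.star_apply, RCLike.star_def,
        RCLike.mul_conj, map_add, ← RCLike.ofReal_pow, RCLike.ofReal_re, RCLike.normSq_eq_def']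
    rw [h]
    have h0 := RCLike.normSq_nonneg (κ.1 0)
    have h1 := RCLike.normSq_nonneg (κ.1 1)
    by_contra hn
    refine κ.2 (funext fun i => ?_)
    fin_cases i
    · exact RCLike.normSq_eq_zero.1 (le_antisymm (show RCLike.normSq (κ.1 0) ≤ 0 by linarith) h0)
    · exact RCLike.normSq_eq_zero.1 (le_antisymm (show RCLike.normSq (κ.1 1) ≤ 0 by linarith) h1)⟩

lemma Spinor.flagpole_apply {𝕜 : Type} [RCLike 𝕜] (κ : Spinor 𝕜) (i j : Fin 2) :
    κ.flagpole.1 i j = κ.1 i * conj (κ.1 j) := rfl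

lemma mink_fin_two {𝕜 : Type} [RCLike 𝕜] (S S' : Matrix (Fin 2) (Fin 2) 𝕜) :
    mink S S' =
      RCLike.re (2 * (S 0 0 * S' 1 1 + S 1 1 * S' 0 0 - S 0 1 * S' 1 0 - S 1 0 * S' 0 1)) := by
  rw [mink]
  congr 2
  simp only [Matrix.trace_fin_two, Matrix.mul_apply, Fin.sum_univ_two]
  ring

lemma Spinor.flagpole_smul {𝕜 : Type} [RCLike 𝕜] (A : SL(2, 𝕜)) (κ : Spinor 𝕜) :
    (A • κ).flagpole = A • κ.flagpole :=
  Subtype.ext (act_vecMulVec A κ.1 κ.1).symm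

lemma Hyp.apply_one_zero {q : Hyp ℂ} : q.1 1 0 = conj (q.1 0 1) := by
  have h := congrFun (congrFun q.2.1.eq 1) 0
  simpa using h.symm

lemma Hyp.im_diag {q : Hyp ℂ} (i : Fin 2) : (q.1 i i).im = 0 := by
  have h := congrFun (congrFun q.2.1.eq i) i
  exact Complex.conj_eq_iff_im.1 (by simpa using h)

/-- The horosphere equation fixes the lower right entry and `4 det q = 1` fixes the upper left one,
so the upper right entry is a global coordinate on the standard horosphere. -/
lemma Hyp.apply_of_mem_std {q : Hyp ℂ} (hq : q ∈ horosphere Spinor.std.flagpole) :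
    q.1 1 1 = 1 / 2 ∧ q.1 0 0 = 1 / 2 + 2 * (q.1 0 1 * conj (q.1 0 1)) := by
  have h : (2 * (q.1 1 1)).re = 1 := by
    have h : mink q.1 Spinor.std.flagpole.1 = 1 := hq
    rw [mink_fin_two] at h
    simpa [Spinor.flagpole_apply, Spinor.std_zero, Spinor.std_one] using h
  have h1 : q.1 1 1 = 1 / 2 := by
    apply Complex.ext
    · simp at h ⊢; linarith
    · rw [Hyp.im_diag]; simp
  refine ⟨h1, ?_⟩
  have hm := q.2.2.1
  rw [mink_fin_two, h1, Hyp.apply_one_zero] at hm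
  apply Complex.ext
  · simp [Complex.mul_conj, Complex.normSq_apply, Hyp.im_diag, -one_div] at hm ⊢
    norm_num at hm ⊢
    linarith
  · rw [Hyp.im_diag, Complex.mul_conj]
    simp

/-- Parabolic translations reach every point of the standard horosphere. The factor 2 undoes the
normalisation `½` of the base point. -/
lemma pt_unip {q : Hyp ℂ} (hq : q ∈ horosphere Spinor.std.flagpole) :
    SpinFrame.pt (unip (2 * q.1 0 1)) = q.1 := by
  obtain ⟨h1, h0⟩ := Hyp.apply_of_mem_std hq
  ext i j
  rw [SpinFrame.pt_apply]
  fin_cases i <;> fin_cases j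
  · simp [unip_coe, h0, Complex.conj_ofNat]; ring
  · simp [unip_coe]
  · simp [unip_coe, Hyp.apply_one_zero, Complex.conj_ofNat]
  · simp [unip_coe, h1]

lemma outwardNormal_of_frame {A : SpinFrame} {p : LightCone ℂ} {q : Hyp ℂ}
    (hp : (A • Spinor.std).flagpole = p) (hq : A.pt = q.1) : A.vec₁ = outwardNormal p q := by
  rw [outwardNormal, ← hq, ← hp, eq_sub_iff_add_eq, add_comm, SpinFrame.pt_add_vec₁]
  rfl

/-- Fixing `e₁e₁*` makes `M` upper triangular, parabolicity makes its diagonal entries equal, and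
the determinant makes them `±1`. Rotations about the centre, which preserve the horosphere too, are
thereby excluded. -/
lemma eq_unip_or_neg_of_isParabolic {M : SL(2, ℂ)} (hM : M.1.IsParabolic)
    (h : M • Spinor.std.flagpole = Spinor.std.flagpole) : ∃ z, M = unip z ∨ M = -unip z := by
  have hc : M.1 1 0 = 0 := by
    have h1 := congrArg (fun p : LightCone ℂ => p.1 1 1) h
    rw [← Spinor.flagpole_smul] at h1
    simp only [Spinor.flagpole_apply, Spinor.smul_std_apply] at h1
    simpa [Spinor.std, Complex.mul_conj] using h1
  have had := ((Matrix.isParabolic_iff_of_upperTriangular hc).1 hM).1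
  have hd := M.2
  rw [Matrix.det_fin_two, hc, ← had] at hd
  have : (M.1 0 0 - 1) * (M.1 0 0 + 1) = 0 := by linear_combination hd
  rcases mul_eq_zero.1 this with h0 | h0
  · have h0 := sub_eq_zero.1 h0
    refine ⟨M.1 0 1, Or.inl ?_⟩
    ext i j
    fin_cases i <;> fin_cases j
    · exact h0
    · rfl
    · exact hc
    · exact had.symm.trans h0
  · have h0 := eq_neg_of_add_eq_zero_left h0
    refine ⟨-M.1 0 1, Or.inr ?_⟩
    ext i j
    rw [Matrix.SpecialLinearGroup.coe_neg]
    fin_cases i <;> fin_cases j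
    · simpa [unip_coe] using h0
    · simp [unip_coe]
    · simpa [unip_coe] using hc
    · simpa [unip_coe] using had.symm.trans h0

lemma two_pt_unip_apply (z : ℂ) : 2 * SpinFrame.pt (unip z) 0 1 = z := by
  rw [SpinFrame.pt_apply]
  simp [unip_coe, mul_div_cancel₀]

/-- The spin-decorated horosphere of the spinor `(1, 0)`. -/
def SpinDecoratedHorosphere.std : SpinDecoratedHorosphere where
  p := Spinor.std.flagpole
  wout q := unip (2 * q.1.1 0 1)
  continuous_wout := by
    refine continuous_unip.comp (continuous_const.mul ?_)
    have h : Continuous fun q : horosphere Spinor.std.flagpole => q.1.1 :=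
      continuous_subtype_val.comp continuous_subtype_val
    exact h.matrix_elem 0 1
  pt_wout q := pt_unip q.2
  vec₁_wout q := outwardNormal_of_frame (by rw [unip_smul_std]) (pt_unip q.2)
  parallel M hM hp q q' hq := by
    obtain ⟨z, hz⟩ := eq_unip_or_neg_of_isParabolic hM hp
    have hact : ∀ S, act M S = act (unip z) S := fun S => by
      rcases hz with rfl | rfl
      · rfl
      · exact act_neg _ _
    have h : q'.1.1 = SpinFrame.pt (unip (2 * q.1.1 0 1 + z)) := by
      rw [hq, Hyp.coe_smul, hact, ← pt_unip q.2, ← SpinFrame.pt_mul, pt_unip q.2, unip_mul]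
    simp only [hact, ← SpinFrame.vec₂_mul, unip_mul]
    rw [h, two_pt_unip_apply]

/-! ### Rigidity: spin-decorated horospheres form a single orbit -/

namespace SpinDecoratedHorosphere

lemma p_eq_flagpole (W : SpinDecoratedHorosphere) (q : horosphere W.p) :
    W.p = (W.wout q • Spinor.std).flagpole := by
  refine Subtype.ext ?_
  change _ = Matrix.vecMulVec _ _
  rw [← SpinFrame.pt_add_vec₁, W.pt_wout, W.vec₁_wout, outwardNormal, add_sub_cancel]

lemma ptHyp_mem {A : SpinFrame} {κ : Spinor ℂ} (h : A • Spinor.std = κ) :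
    A.ptHyp ∈ horosphere κ.flagpole := by
  subst h
  rw [Spinor.flagpole_smul]
  have h1 : A.ptHyp = A • SpinFrame.ptHyp 1 := Subtype.ext (by
    rw [Hyp.coe_smul]; change A.pt = act A (SpinFrame.pt 1); rw [← SpinFrame.pt_mul, mul_one])
  rw [h1]
  refine smul_mem_horosphere A ?_
  change mink (SpinFrame.pt 1) Spinor.std.flagpole.1 = 1
  rw [SpinFrame.pt, act_one, mink_fin_two]
  simp [Spinor.flagpole_apply, Spinor.std_zero, Spinor.std_one]

/-- One frame determines the whole decoration: it fixes `p`, parallel transport then fixes the frame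
field, and the lift of a frame field over a connected horosphere is fixed by its value at one point.
-/
lemma eq_std {W : SpinDecoratedHorosphere} (q₀ : horosphere W.p) (h : W.wout q₀ = 1) :
    W = std := by
  have hp : W.p = std.p := by
    rw [W.p_eq_flagpole q₀, h, one_smul]; rfl
  have hmem : ∀ z, SpinFrame.ptHyp (unip z) ∈ horosphere W.p := fun z => by
    rw [hp]
    exact ptHyp_mem (unip_smul_std z)
  -- `C z` is the discrepancy between the frame of `W` and the standard one at the point with
  -- parameter `z`; it is continuous, takes only the values `±1`, and starts at `1`.
  let C : ℂ → SpinFrame := fun z => (unip z)⁻¹ * W.wout ⟨_, hmem z⟩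
  have hq₀ : q₀ = ⟨SpinFrame.ptHyp (unip 0), hmem 0⟩ := by
    refine Subtype.ext (Subtype.ext ?_)
    rw [← W.pt_wout, h, ← unip_zero]; rfl
  have hC0 : C 0 = 1 := by
    simp only [C]
    rw [← hq₀, h, unip_zero]; simp
  have hcont : Continuous C := by
    refine continuous_unip.inv.mul (W.continuous_wout.comp ?_)
    refine Continuous.subtype_mk (Continuous.subtype_mk ?_ _) _
    change Continuous fun z => act (unip z) _
    have h1 : Continuous fun z => (unip z).1 := continuous_subtype_val.comp continuous_unip
    exact (h1.matrix_mul continuous_const).matrix_mul h1.matrix_conjTranspose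
  have hframe : ∀ z, C z ∈ {C : SpinFrame | C.1 0 0 ^ 2 = 1 ∧ C.1 0 1 = 0 ∧ C.1 1 0 = 0 ∧
      C.1 1 1 = C.1 0 0} := fun z => by
    have hact : ∀ S S', S = act (unip z) S' → act (unip z)⁻¹ S = S' := fun S S' h => by
      rw [h, ← act_mul, inv_mul_cancel, act_one]
    refine SpinFrame.diagonal_of_frame_eq_one ?_ ?_ ?_
    · simp only [C]
      rw [SpinFrame.pt_mul, W.pt_wout]
      refine hact _ _ ?_
      rw [← SpinFrame.pt_mul, mul_one]; rfl
    · simp only [C]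
      rw [SpinFrame.vec₁_mul, W.vec₁_wout]
      refine hact _ _ ?_
      rw [← SpinFrame.vec₁_mul, mul_one]
      refine (outwardNormal_of_frame ?_ rfl).symm
      rw [unip_smul_std, hp]; rfl
    · simp only [C]
      rw [SpinFrame.vec₂_mul]
      refine hact _ _ ?_
      -- The identity is not parabolic, so `z = 0` cannot go through the parallelism hypothesis.
      rcases eq_or_ne z 0 with rfl | hz
      · rw [← hq₀, h, unip_zero, act_one]
      · rw [← h]
        refine W.parallel (unip z) ?_ ?_ q₀ ⟨_, hmem z⟩ ?_
        · exact (Matrix.isParabolic_iff_of_upperTriangular (by simp [unip_coe])).2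
            ⟨by simp [unip_coe], by simpa [unip_coe] using hz⟩
        · rw [hp]
          change unip z • Spinor.std.flagpole = Spinor.std.flagpole
          rw [← Spinor.flagpole_smul, unip_smul_std]
        · rw [hq₀]
          refine Subtype.ext ?_
          rw [Hyp.coe_smul]
          change SpinFrame.pt (unip z) = act (unip z) (SpinFrame.pt (unip 0))
          rw [← SpinFrame.pt_mul, unip_zero, mul_one]
  have hcoe : Continuous fun z => (C z).1 0 0 :=
    (continuous_subtype_val.comp hcont).matrix_elem 0 0
  -- A continuous function on ℂ with square `1` is constant, by connectedness.
  have hone : ∀ z, (C z).1 0 0 = 1 := fun z => by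
    refine isPreconnected_univ.eq_of_sq_eq (f := fun z => (C z).1 0 0) (g := fun _ => (1 : ℂ))
      hcoe.continuousOn continuousOn_const (fun z _ => ?_) (fun _ => one_ne_zero)
      (Set.mem_univ 0) ?_ (Set.mem_univ z)
    · simpa using (hframe z).1
    · simp [hC0]
  refine ext' hp fun q hq hq' => ?_
  have hqz : q = SpinFrame.ptHyp (unip (2 * q.1 0 1)) := Subtype.ext (pt_unip hq').symm
  have hC : C (2 * q.1 0 1) = 1 := by
    obtain ⟨-, h1, h2, h3⟩ := hframe (2 * q.1 0 1)
    ext i j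
    fin_cases i <;> fin_cases j
    · exact hone _
    · exact h1
    · exact h2
    · exact h3.trans (hone _)
  have hw : W.wout ⟨_, hmem (2 * q.1 0 1)⟩ = unip (2 * q.1 0 1) :=
    (inv_mul_eq_one.1 hC).symm
  change _ = unip _
  rw [← hw]
  congr 2

/-- Every spin-decorated horosphere is the image of the standard one under each of its frames. -/
lemma eq_wout_smul_std (W : SpinDecoratedHorosphere) (q : horosphere W.p) :
    W = W.wout q • std := by
  rw [← inv_smul_eq_iff]
  refine eq_std ⟨(W.wout q)⁻¹ • q.1, smul_mem_horosphere _ q.2⟩ ?_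
  rw [smul_wout]
  simp

/-- `unip z` is itself a frame of the standard decoration, and a decorated horosphere is the
translate of the standard one by any of its frames. -/
lemma unip_smul_std (z : ℂ) : unip z • std = std := by
  have hmem : SpinFrame.ptHyp (unip z) ∈ horosphere (std).p := ptHyp_mem (SpinHoro.unip_smul_std z)
  have h := eq_wout_smul_std std ⟨_, hmem⟩
  have hw : std.wout ⟨_, hmem⟩ = unip z := by
    change unip (2 * (SpinFrame.pt (unip z)) 0 1) = _
    rw [two_pt_unip_apply]
  rw [hw] at h
  exact h.symm

/-- `B⁻¹A` fixes `(1, 0)`, hence is a parabolic translation, which fixes the standard decoration. So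
the choice of a frame completing a given spinor does not matter. -/
lemma smul_std_congr {A B : SL(2, ℂ)} (h : A • Spinor.std = B • Spinor.std) : A • std = B • std := by
  rw [← inv_smul_eq_iff, ← mul_smul]
  rw [eq_unip_of_smul_std (A := B⁻¹ * A) (by rw [mul_smul, h, inv_smul_smul]), unip_smul_std]

lemma wout_smul_std_smul_std {A : SL(2, ℂ)} (q : horosphere (A • std).p) :
    (A • std).wout q • Spinor.std = A • Spinor.std := by
  rw [smul_wout, mul_smul]
  change A • unip _ • Spinor.std = _
  rw [SpinHoro.unip_smul_std]

lemma exists_wout_smul_std (A : SL(2, ℂ)) :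
    ∃ q : horosphere (A • std).p, q.1.1 = SpinFrame.pt A ∧ (A • std).wout q = A := by
  refine ⟨⟨SpinFrame.ptHyp A, ?_⟩, rfl, ?_⟩
  · change _ ∈ horosphere (A • Spinor.std.flagpole)
    rw [← Spinor.flagpole_smul]
    exact ptHyp_mem rfl
  · rw [smul_wout]
    change A * unip (2 * (act A⁻¹ (SpinFrame.pt A)) 0 1) = A
    have h : act A⁻¹ (SpinFrame.pt A) = SpinFrame.pt (unip 0) := by
      rw [← SpinFrame.pt_mul, inv_mul_cancel, unip_zero]
    rw [h, two_pt_unip_apply, unip_zero, mul_one]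

end SpinDecoratedHorosphere

/-! ## The spinor of a spin-decorated horosphere -/

section Flagpole

variable {𝕜 : Type} [RCLike 𝕜]

/-- A null Hermitian matrix `[[a, b], [b̄, c]]` satisfies `ac = |b|²`, and positive trace then
forces `c ≥ 0`. An explicit root is `(b/√c, √c)` if `c > 0`, and `(√a, 0)` if `c = 0`. -/
lemma LightCone.exists_flagpole (p : LightCone 𝕜) : ∃ κ : Spinor 𝕜, κ.flagpole = p := by
  obtain ⟨S, hS, hm, ht⟩ := p
  have h10 : S 1 0 = conj (S 0 1) := by
    have h := congrFun (congrFun hS.eq 1) 0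
    simpa using h.symm
  have hre : ∀ i, S i i = (RCLike.re (S i i) : 𝕜) := fun i => by
    have h := congrFun (congrFun hS.eq i) i
    exact (RCLike.conj_eq_iff_re.1 (by simpa using h)).symm
  set a := RCLike.re (S 0 0) with ha
  set b := S 0 1 with hb
  set c := RCLike.re (S 1 1) with hc
  have hdet : a * c = RCLike.normSq b := by
    rw [mink_fin_two, h10, hre 0, hre 1, ← ha, ← hc, RCLike.mul_conj, RCLike.conj_mul] at hm
    have h : (2 * ((a : 𝕜) * c + c * a - (‖b‖ : 𝕜) ^ 2 - (‖b‖ : 𝕜) ^ 2)) =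
        ((2 * (a * c + c * a - ‖b‖ ^ 2 - ‖b‖ ^ 2) : ℝ) : 𝕜) := by
      push_cast; ring
    rw [h, RCLike.ofReal_re] at hm
    rw [RCLike.normSq_eq_def']
    linarith
  have htr : 0 < a + c := by
    simpa [Matrix.trace_fin_two] using ht
  have hac : 0 ≤ a * c := hdet ▸ RCLike.normSq_nonneg b
  have hc0 : 0 ≤ c := by
    by_contra h
    nlinarith
  rcases hc0.eq_or_lt with h0 | hpos
  · have hb0 : b = 0 := by
      rw [← h0, mul_zero] at hdet
      exact RCLike.normSq_eq_zero.1 hdet.symm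
    have ha0 : 0 < a := by linarith
    refine ⟨⟨![(√a : 𝕜), 0], fun h => ?_⟩, Subtype.ext ?_⟩
    · have := congrFun h 0
      simp [Real.sqrt_ne_zero'.2 ha0] at this
    · ext i j
      fin_cases i <;> fin_cases j
      · change (√a : 𝕜) * conj (√a : 𝕜) = S 0 0
        rw [RCLike.conj_ofReal, ← RCLike.ofReal_mul, Real.mul_self_sqrt ha0.le, ha, ← hre]
      · change (√a : 𝕜) * conj (0 : 𝕜) = S 0 1
        rw [map_zero, mul_zero, ← hb, hb0]
      · change 0 * conj (√a : 𝕜) = S 1 0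
        rw [zero_mul, h10, hb0, map_zero]
      · change 0 * conj (0 : 𝕜) = S 1 1
        rw [zero_mul, hre, ← hc, ← h0, RCLike.ofReal_zero]
  · have hs : (√c : 𝕜) ≠ 0 := RCLike.ofReal_ne_zero.2 (Real.sqrt_ne_zero'.2 hpos)
    have hss : (√c : 𝕜) * √c = c := by rw [← RCLike.ofReal_mul, Real.mul_self_sqrt hpos.le]
    refine ⟨⟨![b / √c, (√c : 𝕜)], fun h => hs (congrFun h 1)⟩, Subtype.ext ?_⟩
    ext i j
    fin_cases i <;> fin_cases j
    · change b / (√c : 𝕜) * conj (b / (√c : 𝕜)) = S 0 0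
      rw [map_div₀, RCLike.conj_ofReal, div_mul_div_comm, hss, RCLike.mul_conj, hre, ← ha,
        ← RCLike.ofReal_pow, ← RCLike.normSq_eq_def', ← hdet, RCLike.ofReal_mul,
        mul_div_cancel_right₀ _ (RCLike.ofReal_ne_zero.2 hpos.ne')]
    · change b / (√c : 𝕜) * conj (√c : 𝕜) = S 0 1
      rw [RCLike.conj_ofReal, div_mul_cancel₀ _ hs]
    · change (√c : 𝕜) * conj (b / (√c : 𝕜)) = S 1 0
      rw [map_div₀, RCLike.conj_ofReal, mul_div_cancel₀ _ hs, h10]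
    · change (√c : 𝕜) * conj (√c : 𝕜) = S 1 1
      rw [RCLike.conj_ofReal, hss, hre]

end Flagpole

lemma Spinor.sum_mul_conj_ne_zero (κ : Spinor ℂ) :
    κ.1 0 * conj (κ.1 0) + κ.1 1 * conj (κ.1 1) ≠ 0 := by
  intro h
  have h := congrArg Complex.re h
  simp only [Complex.mul_conj, Complex.add_re, Complex.ofReal_re, Complex.zero_re] at h
  have h0 := Complex.normSq_nonneg (κ.1 0)
  have h1 := Complex.normSq_nonneg (κ.1 1)
  refine κ.2 (funext fun i => ?_)
  fin_cases i
  · exact Complex.normSq_eq_zero.1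
      (le_antisymm (show Complex.normSq (κ.1 0) ≤ 0 by linarith) h0)
  · exact Complex.normSq_eq_zero.1
      (le_antisymm (show Complex.normSq (κ.1 1) ≤ 0 by linarith) h1)

/-- A spin frame with first column a given spinor, depending continuously on it. -/
def Spinor.toFrame (κ : Spinor ℂ) : SL(2, ℂ) :=
  ⟨!![κ.1 0, -conj (κ.1 1) / (κ.1 0 * conj (κ.1 0) + κ.1 1 * conj (κ.1 1));
      κ.1 1, conj (κ.1 0) / (κ.1 0 * conj (κ.1 0) + κ.1 1 * conj (κ.1 1))], by
    have h := κ.sum_mul_conj_ne_zero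
    rw [Matrix.det_fin_two_of]
    field_simp
    ring⟩

lemma Spinor.toFrame_smul_std (κ : Spinor ℂ) : κ.toFrame • Spinor.std = κ := by
  refine Subtype.ext (funext fun i => ?_)
  rw [Spinor.smul_std_apply]
  fin_cases i <;> rfl

lemma Spinor.continuous_toFrame : Continuous Spinor.toFrame := by
  refine Continuous.subtype_mk (continuous_matrix fun i j => ?_) _
  have h : ∀ i, Continuous fun κ : Spinor ℂ => κ.1 i := fun i =>
    (continuous_apply i).comp continuous_subtype_val
  have h0 := h 0
  have h1 := h 1
  have hn : Continuous fun κ : Spinor ℂ => κ.1 0 * conj (κ.1 0) + κ.1 1 * conj (κ.1 1) :=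
    (h0.mul (Complex.continuous_conj.comp h0)).add (h1.mul (Complex.continuous_conj.comp h1))
  fin_cases i <;> fin_cases j
  · exact h0
  · exact (Complex.continuous_conj.comp h1).neg.div hn Spinor.sum_mul_conj_ne_zero
  · exact h1
  · exact (Complex.continuous_conj.comp h0).div hn Spinor.sum_mul_conj_ne_zero

namespace SpinDecoratedHorosphere

instance (W : SpinDecoratedHorosphere) : Nonempty (horosphere W.p) := by
  obtain ⟨κ, h⟩ := W.p.exists_flagpole
  rw [← h]
  exact ⟨⟨_, ptHyp_mem κ.toFrame_smul_std⟩⟩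

/-- The spinor of a spin-decorated horosphere: the first column of each of its spin frames. -/
def spinor (W : SpinDecoratedHorosphere) : Spinor ℂ :=
  W.wout (Classical.arbitrary _) • Spinor.std

lemma spinor_smul_std (A : SL(2, ℂ)) : (A • std).spinor = A • Spinor.std :=
  wout_smul_std_smul_std _

lemma exists_eq_smul_std (W : SpinDecoratedHorosphere) : ∃ A : SL(2, ℂ), W = A • std :=
  ⟨_, W.eq_wout_smul_std (Classical.arbitrary _)⟩

lemma wout_smul_std (W : SpinDecoratedHorosphere) (q : horosphere W.p) :
    W.wout q • Spinor.std = W.spinor := by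
  obtain ⟨A, rfl⟩ := W.exists_eq_smul_std
  rw [spinor_smul_std, wout_smul_std_smul_std]

lemma spinor_smul (A : SL(2, ℂ)) (W : SpinDecoratedHorosphere) :
    (A • W).spinor = A • W.spinor := by
  obtain ⟨B, rfl⟩ := W.exists_eq_smul_std
  rw [← mul_smul, spinor_smul_std, spinor_smul_std, mul_smul]

lemma spinor_flagpole (W : SpinDecoratedHorosphere) : W.spinor.flagpole = W.p :=
  (W.p_eq_flagpole _).symm

lemma exists_wout_eq (W : SpinDecoratedHorosphere) {A : SL(2, ℂ)} (h : A • Spinor.std = W.spinor) :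
    ∃ q : horosphere W.p, q.1.1 = SpinFrame.pt A ∧ W.wout q = A := by
  obtain ⟨B, rfl⟩ := W.exists_eq_smul_std
  rw [spinor_smul_std] at h
  rw [← smul_std_congr h]
  exact exists_wout_smul_std A

lemma continuous_smul_left (W : SpinDecoratedHorosphere) :
    Continuous fun A : SL(2, ℂ) => A • W :=
  continuous_iSup_rng (i := W) continuous_coinduced_rng

/-- Continuity out of the homogeneous-space topology is tested on orbit maps, where equivariance
reduces it to `A ↦ A • κ` for a fixed spinor. -/
lemma continuous_spinor : Continuous spinor := by
  refine continuous_iSup_dom.2 fun W => continuous_coinduced_dom.2 ?_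
  have h : (spinor ∘ fun A : SL(2, ℂ) => A • W) = fun A => A • W.spinor :=
    funext fun A => spinor_smul A W
  rw [h]
  exact Continuous.subtype_mk (continuous_subtype_val.matrix_mulVec continuous_const) _

end SpinDecoratedHorosphere

/-! ### The spinor correspondence and null flags -/

open SpinDecoratedHorosphere

/-- The correspondence between nonzero spinors and spin-decorated horospheres. -/
def spinorHomeomorph : Spinor ℂ ≃ₜ SpinDecoratedHorosphere where
  toFun κ := κ.toFrame • std
  invFun := spinor
  left_inv κ := by rw [spinor_smul_std, κ.toFrame_smul_std]
  right_inv W := by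
    obtain ⟨A, rfl⟩ := W.exists_eq_smul_std
    exact smul_std_congr (by rw [Spinor.toFrame_smul_std, spinor_smul_std])
  continuous_toFun := std.continuous_smul_left.comp Spinor.continuous_toFrame
  continuous_invFun := continuous_spinor

lemma spinor_spinorHomeomorph (κ : Spinor ℂ) : (spinorHomeomorph κ).spinor = κ :=
  spinorHomeomorph.symm_apply_apply κ

lemma spinorHomeomorph_spinor (W : SpinDecoratedHorosphere) : spinorHomeomorph W.spinor = W :=
  spinorHomeomorph.apply_symm_apply W

lemma spinorHomeomorph_smul (A : SL(2, ℂ)) (κ : Spinor ℂ) :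
    spinorHomeomorph (A • κ) = A • spinorHomeomorph κ := by
  rw [← spinorHomeomorph_spinor (A • spinorHomeomorph κ), spinor_smul, spinor_spinorHomeomorph]

lemma spinorHomeomorph_p (κ : Spinor ℂ) : (spinorHomeomorph κ).p = κ.flagpole := by
  rw [← spinor_flagpole, spinor_spinorHomeomorph]

/-- Two spin frames with the same first column differ by a parabolic translation. -/
lemma exists_eq_mul_unip {A B : SL(2, ℂ)} (h : A • Spinor.std = B • Spinor.std) :
    ∃ z, A = B * unip z :=
  ⟨_, by rw [← eq_unip_of_smul_std (A := B⁻¹ * A) (by rw [mul_smul, h, inv_smul_smul]),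
    mul_inv_cancel_left]⟩

/-- Each frame is `κ.toFrame * unip z`. The second vector of `κ.toFrame` is `1 / (2‖κ‖²)` times the
flag direction, and right multiplication by `unip z` adds `Im z` times `p`. -/
lemma liesOver_spinorHomeomorph (κ : Spinor ℂ) : LiesOver (spinorHomeomorph κ) κ := by
  have hp := spinorHomeomorph_p κ
  refine ⟨by rw [hp]; rfl, fun q => ?_⟩
  have hq := (spinorHomeomorph κ).wout_smul_std q
  rw [spinor_spinorHomeomorph] at hq
  obtain ⟨z, hz⟩ := exists_eq_mul_unip (hq.trans κ.toFrame_smul_std.symm)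
  set n := Complex.normSq (κ.1 0) + Complex.normSq (κ.1 1) with hn
  have hnc : κ.1 0 * conj (κ.1 0) + κ.1 1 * conj (κ.1 1) = n := by
    simp [Complex.mul_conj, hn]
  have hn0 : (n : ℂ) ≠ 0 := hnc ▸ κ.sum_mul_conj_ne_zero
  have hnpos : 0 < n := lt_of_le_of_ne
    (add_nonneg (Complex.normSq_nonneg _) (Complex.normSq_nonneg _))
    (fun h => hn0 (by rw [← h, Complex.ofReal_zero]))
  refine ⟨z.im, 1 / (2 * n), by positivity, ?_⟩
  have hframe : κ.toFrame.1 = !![κ.1 0, -conj (κ.1 1) / n; κ.1 1, conj (κ.1 0) / n] := by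
    rw [← hnc]; rfl
  have hz2 : (z.im : ℂ) * 2 * Complex.I = z - conj z := by
    rw [Complex.sub_conj]; push_cast; ring
  have hzim : (z.im : ℂ) = Complex.I * (conj z - z) / 2 := by
    linear_combination (-(Complex.I) / 2) * hz2 + z.im * Complex.I_sq
  ext i j
  rw [SpinDecoratedHorosphere.decoration, SpinFrame.vec₂_apply, hz,
    Matrix.SpecialLinearGroup.coe_mul, hframe, unip_coe, hp]
  rw [Matrix.add_apply, Matrix.smul_apply, Matrix.smul_apply, Spinor.flagpole_apply, dphi,
    Matrix.add_apply, Matrix.vecMulVec_apply, Matrix.vecMulVec_apply, Complex.real_smul,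
    Complex.real_smul, hzim]
  fin_cases i <;> fin_cases j <;> simp [Matrix.mul_apply, Fin.sum_univ_two, zdir] <;>
    field_simp <;> ring

/-! ## Complex lambda lengths -/

/-- The centre of `κκ*` is `ξ/η`, so equality of centres is the cross-multiplied relation `ξη' =
ηξ'`. -/
lemma centre_flagpole_eq_iff (κ κ' : Spinor ℂ) :
    centre κ.flagpole = centre κ'.flagpole ↔ symp κ κ' = 0 := by
  have hcentre : ∀ κ : Spinor ℂ, centre κ.flagpole =
      if κ.1 1 = 0 then OnePoint.infty else ((κ.1 0 / κ.1 1 : ℂ) : OnePoint ℂ) := fun κ => by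
    rw [centre, Spinor.flagpole_apply, Spinor.flagpole_apply]
    by_cases h : κ.1 1 = 0
    · simp [h]
    · have h' : conj (κ.1 1) ≠ 0 := (map_ne_zero _).2 h
      rw [if_neg (mul_ne_zero h h'), if_neg h, mul_div_mul_right _ _ h']
  have hne : ∀ κ : Spinor ℂ, κ.1 1 = 0 → κ.1 0 ≠ 0 := fun κ h h' =>
    κ.2 (funext fun i => by fin_cases i; exacts [h', h])
  rw [hcentre, hcentre, symp]
  by_cases h : κ.1 1 = 0 <;> by_cases h' : κ'.1 1 = 0
  · simp [h, h']
  · simp [h, h', hne κ h]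
  · simp [h, h', hne κ' h']
  · rw [if_neg h, if_neg h', OnePoint.coe_eq_coe, div_eq_div_iff h h', sub_eq_zero,
      mul_comm (κ'.1 0)]

/-- Rotation by `π` in the spin group uses the half angle `π/2`, so it swaps the columns with one
sign. -/
lemma win_apply (W : SpinDecoratedHorosphere) (q : horosphere W.p) :
    (W.win q).1 = !![(W.wout q).1 0 1, -(W.wout q).1 0 0; (W.wout q).1 1 1, -(W.wout q).1 1 0] := by
  change (W.wout q).1 * !![(Real.cos (Real.pi / 2) : ℂ), -(Real.sin (Real.pi / 2) : ℂ);
    (Real.sin (Real.pi / 2) : ℂ), (Real.cos (Real.pi / 2) : ℂ)] = _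
  ext i j
  fin_cases i <;> fin_cases j <;> simp [Matrix.mul_apply, Fin.sum_univ_two]

/-- Translation and rotation along the first vector are the two factors of the complex torus `diag
(exp (d/2), exp (-d/2))`. -/
lemma coe_translate_rotate₁ (A : SpinFrame) (d : ℂ) :
    ((A.translate d.re).rotate₁ d.im).1 =
      !![A.1 0 0 * Complex.exp (d / 2), A.1 0 1 * Complex.exp (-(d / 2));
        A.1 1 0 * Complex.exp (d / 2), A.1 1 1 * Complex.exp (-(d / 2))] := by
  have h1 : Complex.exp (d / 2) = Complex.exp (d.re / 2) * Complex.exp (d.im / 2 * Complex.I) := by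
    rw [← Complex.exp_add]
    congr 1
    linear_combination (-(1 / 2 : ℂ)) * Complex.re_add_im d
  have h2 : Complex.exp (-(d / 2)) =
      Complex.exp (-(d.re / 2)) * Complex.exp (-(d.im / 2 * Complex.I)) := by
    rw [← Complex.exp_add]
    congr 1
    linear_combination (1 / 2 : ℂ) * Complex.re_add_im d
  rw [h1, h2]
  change A.1 * !![(Real.exp (d.re / 2) : ℂ), 0; 0, (Real.exp (-(d.re / 2)) : ℂ)] *
    !![Complex.exp (d.im / 2 * Complex.I), 0; 0, Complex.exp (-(d.im / 2 * Complex.I))] = _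
  ext i j
  fin_cases i <;> fin_cases j <;> simp [Matrix.mul_apply, Fin.sum_univ_two] <;> ring

/-- Comparing first columns gives `κ' = exp (d/2) c₂`, where `(κ, c₂)` is an outward frame of `W`;
pairing with `κ` and using `det (κ, c₂) = 1` evaluates the form. -/
lemma isComplexLambdaLength_iff (W W' : SpinDecoratedHorosphere) (l : ℂ) :
    IsComplexLambdaLength W W' l ↔ l = symp W.spinor W'.spinor := by
  have hcentre : centre W.p = centre W'.p ↔ symp W.spinor W'.spinor = 0 := by
    rw [← spinor_flagpole W, ← spinor_flagpole W', centre_flagpole_eq_iff]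
  rw [IsComplexLambdaLength, ne_eq, hcentre]
  by_cases hD : symp W.spinor W'.spinor = 0
  · simp [hD]
  simp only [hD, false_and, false_or, not_false_eq_true, true_and]
  have hcol : ∀ (W : SpinDecoratedHorosphere) q i, (W.wout q).1 i 0 = W.spinor.1 i :=
    fun W q i => by rw [← W.wout_smul_std q, Spinor.smul_std_apply]
  constructor
  · rintro ⟨q₁, q₂, d, -, -, hd, rfl⟩
    have h := congrArg Subtype.val hd
    rw [coe_translate_rotate₁, win_apply] at h
    have h0 := congrFun (congrFun h 0) 0
    have h1 := congrFun (congrFun h 1) 0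
    simp only [hcol] at h0 h1
    have hdet := (W.wout q₁).2
    rw [Matrix.det_fin_two, hcol, hcol] at hdet
    simp only [Matrix.of_apply, Matrix.cons_val', Matrix.cons_val_zero, Matrix.cons_val_one,
      Matrix.cons_val_fin_one] at h0 h1
    rw [symp, h0, h1]
    linear_combination (-Complex.exp (d / 2)) * hdet
  · intro hl
    set D := symp W.spinor W'.spinor with hDdef
    set κ := W.spinor
    set κ' := W'.spinor
    have hp : W.p = κ.flagpole := W.spinor_flagpole.symm
    have hp' : W'.p = κ'.flagpole := W'.spinor_flagpole.symm
    have hDeq : κ.1 0 * κ'.1 1 - κ.1 1 * κ'.1 0 = D := rfl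
    -- At the feet of the common geodesic the frames have both columns proportional to `κ` and `κ'`;
    -- determinant one dictates the factors `1/D` and `-1/D`.
    let A : SL(2, ℂ) := ⟨!![κ.1 0, κ'.1 0 / D; κ.1 1, κ'.1 1 / D], by
      rw [Matrix.det_fin_two_of]
      field_simp
      linear_combination hDeq⟩
    let B : SL(2, ℂ) := ⟨!![κ'.1 0, -κ.1 0 / D; κ'.1 1, -κ.1 1 / D], by
      rw [Matrix.det_fin_two_of]
      field_simp
      linear_combination hDeq⟩
    have hA : A • Spinor.std = κ := Subtype.ext (funext fun i => by
      rw [Spinor.smul_std_apply]; fin_cases i <;> rfl)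
    have hB : B • Spinor.std = κ' := Subtype.ext (funext fun i => by
      rw [Spinor.smul_std_apply]; fin_cases i <;> rfl)
    obtain ⟨q₁, hq₁, hw₁⟩ := W.exists_wout_eq hA
    obtain ⟨q₂, hq₂, hw₂⟩ := W'.exists_wout_eq hB
    have hexp : Complex.exp (2 * Complex.log D / 2) = D := by
      rw [mul_div_cancel_left₀ _ two_ne_zero, Complex.exp_log hD]
    have hDD : ((Complex.normSq D : ℝ) : ℂ) = D * conj D := (Complex.mul_conj D).symm
    have hcD : conj D ≠ 0 := (map_ne_zero _).2 hD
    -- The base point of a frame is half the sum of the rank-one forms of its columns, which gives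
    -- these coefficients along the geodesic. Any logarithm serves, since only `exp (d/2) = D`
    -- matters.
    refine ⟨q₁, q₂, 2 * Complex.log D, ⟨1 / 2, 1 / (2 * Complex.normSq D), ?_⟩,
      ⟨1 / (2 * Complex.normSq D), 1 / 2, ?_⟩, ?_, by rw [hexp, hl]⟩
    · rw [hq₁, hp, hp']
      ext i j
      rw [SpinFrame.pt_apply, Matrix.add_apply, Matrix.smul_apply, Matrix.smul_apply,
        Spinor.flagpole_apply, Spinor.flagpole_apply, Complex.real_smul, Complex.real_smul]
      push_cast
      rw [hDD]
      fin_cases i <;> fin_cases j <;> simp [A] <;> field_simp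
    · rw [hq₂, hp, hp']
      ext i j
      rw [SpinFrame.pt_apply, Matrix.add_apply, Matrix.smul_apply, Matrix.smul_apply,
        Spinor.flagpole_apply, Spinor.flagpole_apply, Complex.real_smul, Complex.real_smul]
      push_cast
      rw [hDD]
      fin_cases i <;> fin_cases j <;> simp [B] <;> field_simp <;> ring
    · refine Subtype.ext ?_
      rw [coe_translate_rotate₁, win_apply, hw₁, hw₂, Complex.exp_neg, hexp]
      ext i j
      fin_cases i <;> fin_cases j <;> simp [A, B, div_eq_mul_inv, hD]

/-! ## Plücker coordinates and normal forms of tuples of spinors -/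

section Plucker

variable {𝕜 : Type} [RCLike 𝕜] {d : ℕ}

lemma plucker_rowWedge (M : Matrix (Fin 2) (Fin d) 𝕜) (i j : Fin d) :
    plucker i j (rowWedge M) = minor M i j := by
  rw [plucker, rowWedge, exteriorPower.alternatingMapLinearEquiv_apply_ιMulti]
  rfl

lemma minor_apply (M : Matrix (Fin 2) (Fin d) 𝕜) (i j : Fin d) :
    minor M i j = M 0 i * M 1 j - M 0 j * M 1 i := by
  rw [minor, Matrix.det_fin_two]
  rfl

lemma plucker_rowWedge_spinorMatrix (κ : Fin d → Spinor 𝕜) (i j : Fin d) :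
    plucker i j (rowWedge (spinorMatrix κ)) = symp (κ i) (κ j) := by
  rw [plucker_rowWedge, minor_apply, symp]
  simp only [spinorMatrix, Matrix.of_apply]
  ring

lemma continuous_plucker (i j : Fin d) :
    Continuous fun ω : ⋀[𝕜]^2 (Fin d → 𝕜) => plucker i j ω :=
  (continuous_apply j).comp ((continuous_apply i).comp
    (continuous_induced_dom (f := fun ω => fun i j : Fin d => plucker (𝕜 := 𝕜) i j ω)))

lemma continuous_rowWedge {X : Type*} [TopologicalSpace X] {ω : X → ⋀[𝕜]^2 (Fin d → 𝕜)}
    (h : ∀ i j, Continuous fun x => plucker i j (ω x)) : Continuous ω :=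
  continuous_induced_rng.2 (continuous_pi fun i => continuous_pi fun j => h i j)

lemma symp_smul (A : SL(2, 𝕜)) (κ κ' : Spinor 𝕜) : symp (A • κ) (A • κ') = symp κ κ' := by
  have hA := A.2
  rw [Matrix.det_fin_two] at hA
  simp only [symp, Spinor.coe_smul, Matrix.mulVec, dotProduct, Fin.sum_univ_two]
  linear_combination (κ.1 0 * κ'.1 1 - κ.1 1 * κ'.1 0) * hA

lemma symp_self (κ : Spinor 𝕜) : symp κ κ = 0 := by
  rw [symp]; ring

lemma symp_swap (κ κ' : Spinor 𝕜) : symp κ κ' = -symp κ' κ := by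
  rw [symp, symp]; ring

lemma continuous_symp : Continuous fun x : Spinor 𝕜 × Spinor 𝕜 => symp x.1 x.2 := by
  have h : ∀ i, Continuous fun κ : Spinor 𝕜 => κ.1 i := fun i =>
    (continuous_apply i).comp continuous_subtype_val
  exact (((h 0).comp continuous_fst).mul ((h 1).comp continuous_snd)).sub
    (((h 1).comp continuous_fst).mul ((h 0).comp continuous_snd))

/-- Expanding bilinearly, the diagonal terms vanish and the cross terms combine into the
determinant. With determinant one this is the SL(2)-invariance of `R₁ ∧ R₂`. -/
lemma alternatingMap_fin_two {R M N : Type*} [CommRing R] [AddCommGroup M] [Module R M]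
    [AddCommGroup N] [Module R N] (f : M [⋀^Fin 2]→ₗ[R] N) (a b c d : R) (x y : M) :
    f ![a • x + b • y, c • x + d • y] = (a * d - b * c) • f ![x, y] := by
  have hswap : ∀ u v : M, f ![u, v] = -f ![v, u] := fun u v => by
    rw [← neg_eq_iff_eq_neg, ← f.map_swap ![u, v] (show (0 : Fin 2) ≠ 1 from zero_ne_one)]
    congr 1
    ext i
    fin_cases i <;> rfl
  have hself : ∀ u : M, f ![u, u] = 0 := fun u =>
    f.map_eq_zero_of_eq ![u, u] (i := 0) (j := 1) rfl zero_ne_one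
  have hleft : ∀ (a b : R) (u v w : M), f ![a • u + b • v, w] = a • f ![u, w] + b • f ![v, w] :=
    fun a b u v w => by rw [f.map_vecCons_add, f.map_vecCons_smul, f.map_vecCons_smul]
  rw [hleft, hswap x, hswap y, hleft, hleft, hself, hself, hswap y x]
  module

lemma rowWedge_smul (A : SL(2, 𝕜)) (κ : Fin d → Spinor 𝕜) :
    rowWedge (spinorMatrix fun i => A • κ i) = rowWedge (spinorMatrix κ) := by
  have hrow : ∀ κ : Fin d → Spinor 𝕜,
      (spinorMatrix κ).row = ![(spinorMatrix κ).row 0, (spinorMatrix κ).row 1] := fun κ => by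
    ext i
    fin_cases i <;> rfl
  have hcomb : ∀ a, (spinorMatrix fun i => A • κ i).row a =
      A.1 a 0 • (spinorMatrix κ).row 0 + A.1 a 1 • (spinorMatrix κ).row 1 := fun a => by
    ext i
    simp [spinorMatrix, Spinor.coe_smul, Matrix.mulVec, dotProduct, Fin.sum_univ_two]
  have hA := A.2
  rw [Matrix.det_fin_two] at hA
  rw [rowWedge, rowWedge, hrow (fun i => A • κ i), hcomb, hcomb, alternatingMap_fin_two, hA,
    one_smul, ← hrow]

lemma linearIndependent_row {M : Matrix (Fin 2) (Fin d) 𝕜} {a b : Fin d} (h : minor M a b ≠ 0) :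
    LinearIndependent 𝕜 M.row := by
  have hrow : M.row = ![M.row 0, M.row 1] := by
    ext i
    fin_cases i <;> rfl
  rw [hrow, LinearIndependent.pair_iff]
  intro s t hst
  have ha : s * M 0 a + t * M 1 a = 0 := congrFun hst a
  have hb : s * M 0 b + t * M 1 b = 0 := congrFun hst b
  rw [minor_apply] at h
  constructor
  · refine (mul_eq_zero.1 ?_).resolve_right h
    linear_combination M 1 b * ha - M 1 a * hb
  · refine (mul_eq_zero.1 ?_).resolve_right h
    linear_combination M 0 a * hb - M 0 b * ha

/-- A zero column would kill every minor that involves it. -/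
lemma exists_spinorMatrix_eq {M : Matrix (Fin 2) (Fin d) 𝕜}
    (h : ∀ i, ∃ j, minor M i j ≠ 0) : ∃ κ : Fin d → Spinor 𝕜, spinorMatrix κ = M := by
  refine ⟨fun i => ⟨fun a => M a i, fun h0 => ?_⟩, rfl⟩
  obtain ⟨j, hj⟩ := h i
  refine hj ?_
  have h0 := fun a => congrFun h0 a
  simp only [Pi.zero_apply] at h0
  rw [minor_apply, h0, h0]
  ring

/-- The columns of the matrix in normal form representing a decomposable `ω` in `Λ²(𝕜^d)`: the
columns `a` and `b` are `(1, 0)` and `(0, p_ab)`. -/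
def normalColumn (a b : Fin d) (ω : ⋀[𝕜]^2 (Fin d → 𝕜)) (j : Fin d) : Fin 2 → 𝕜 :=
  ![-(plucker b j ω / plucker a b ω), plucker a j ω]

/-- Cramer's rule: in the basis `κ_a`, `κ_b / p_ab`, of determinant one, the coordinates of `κ_j`
are `{κ_j, κ_b} / p_ab` and `{κ_a, κ_j}`. They involve only Plücker coordinates, so the wedge
determines the tuple up to SL(2). -/
lemma exists_smul_eq_normalColumn (κ : Fin d → Spinor 𝕜) {a b : Fin d}
    (h : symp (κ a) (κ b) ≠ 0) :
    ∃ A : SL(2, 𝕜), ∀ j, (A • κ j).1 = normalColumn a b (rowWedge (spinorMatrix κ)) j := by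
  refine ⟨⟨!![(κ b).1 1 / symp (κ a) (κ b), -(κ b).1 0 / symp (κ a) (κ b);
    -(κ a).1 1, (κ a).1 0], ?_⟩, fun j => ?_⟩
  · rw [Matrix.det_fin_two_of]
    field_simp
    rw [symp]
    ring
  · rw [normalColumn, plucker_rowWedge_spinorMatrix, plucker_rowWedge_spinorMatrix,
      plucker_rowWedge_spinorMatrix]
    change !![(κ b).1 1 / symp (κ a) (κ b), -(κ b).1 0 / symp (κ a) (κ b);
      -(κ a).1 1, (κ a).1 0] *ᵥ (κ j).1 = _
    ext i
    fin_cases i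
    · simp [Matrix.mulVec, dotProduct, Fin.sum_univ_two]
      rw [symp.eq_def (κ b) (κ j)]
      ring
    · simp [Matrix.mulVec, dotProduct, Fin.sum_univ_two]
      rw [symp]
      ring

lemma continuous_normalColumn {X : Type*} [TopologicalSpace X] {ω : X → ⋀[𝕜]^2 (Fin d → 𝕜)}
    (hω : Continuous ω) {a b : Fin d} (h : ∀ x, plucker a b (ω x) ≠ 0) (j : Fin d) :
    Continuous fun x => normalColumn a b (ω x) j := by
  refine continuous_pi fun i => ?_
  fin_cases i
  · exact (((continuous_plucker b j).comp hω).div ((continuous_plucker a b).comp hω) h).neg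
  · exact (continuous_plucker a j).comp hω

end Plucker

/-! ## Skew ideal polygons -/

section Skew

variable {d : ℕ}

lemma rowWedge_mem_nonzero {κ : Fin d → Spinor ℂ} {a b : Fin d} (hab : a ≠ b)
    (h : ∀ i j, i ≠ j → symp (κ i) (κ j) ≠ 0) :
    rowWedge (spinorMatrix κ) ∈ affineCone (nonzeroGrassmannian d) := by
  have hm : ∀ i j, i ≠ j → minor (spinorMatrix κ) i j ≠ 0 := fun i j hij => by
    rw [← plucker_rowWedge, plucker_rowWedge_spinorMatrix]
    exact h i j hij
  exact ⟨spinorMatrix κ, linearIndependent_row (hm a b hab),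
    ⟨spinorMatrix κ, fun i j hij => hm i j hij.ne, rfl⟩, rfl⟩

lemma XNonzero.exists_spinors {a b : Fin d} (hab : a ≠ b) (ω : XNonzero d) :
    ∃ κ : Fin d → Spinor ℂ, (∀ i j, i ≠ j → symp (κ i) (κ j) ≠ 0) ∧
      ω.1 = rowWedge (spinorMatrix κ) := by
  obtain ⟨ω, M, hM, ⟨M', hM', hspan⟩, rfl⟩ := ω
  have hmem : ∀ r, ∃ s t : ℂ, s • M.row 0 + t • M.row 1 = M'.row r := fun r => by
    have h : M'.row r ∈ Submodule.span ℂ (Set.range M.row) := by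
      rw [hspan]
      exact Submodule.subset_span ⟨r, rfl⟩
    have hrange : Set.range M.row = {M.row 0, M.row 1} := by
      ext x
      simp [Fin.exists_fin_two, eq_comm]
    rw [hrange] at h
    exact Submodule.mem_span_pair.1 h
  obtain ⟨s, t, h0⟩ := hmem 0
  obtain ⟨u, v, h1⟩ := hmem 1
  have h0 : ∀ i, M' 0 i = s * M 0 i + t * M 1 i := fun i => (congrFun h0 i).symm
  have h1 : ∀ i, M' 1 i = u * M 0 i + v * M 1 i := fun i => (congrFun h1 i).symm
  -- The basis `M'` with nonzero minors spans the same plane as `M`, so its minors are those of `M`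
  -- times the determinant of the change of basis.
  have hlt : ∀ i j, i < j → minor M i j ≠ 0 := fun i j hij hz => by
    refine hM' i j hij ?_
    rw [minor_apply] at hz ⊢
    rw [h0, h0, h1, h1]
    linear_combination (s * v - t * u) * hz
  have hne : ∀ i j, i ≠ j → minor M i j ≠ 0 := fun i j hij => by
    rcases lt_or_gt_of_ne hij with h | h
    · exact hlt i j h
    · intro hz
      refine hlt j i h ?_
      rw [minor_apply] at hz ⊢
      linear_combination -hz
  obtain ⟨κ, rfl⟩ := exists_spinorMatrix_eq (M := M) fun i => by
    rcases eq_or_ne i a with rfl | hi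
    · exact ⟨b, hne _ _ hab⟩
    · exact ⟨a, hne _ _ hi⟩
  refine ⟨κ, fun i j hij => ?_, rfl⟩
  rw [← plucker_rowWedge_spinorMatrix, plucker_rowWedge]
  exact hne i j hij

lemma SpinPolygon.symp_ne_zero (G : SpinPolygon d) (i j : Fin d) (hij : i ≠ j) :
    symp (G.1 i).spinor (G.1 j).spinor ≠ 0 := by
  rw [ne_eq, ← centre_flagpole_eq_iff, SpinDecoratedHorosphere.spinor_flagpole,
    SpinDecoratedHorosphere.spinor_flagpole]
  exact fun h => hij (G.2 h)

/-- The skew ideal polygon of a tuple of spinors. -/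
def SpinPolygon.ofSpinors (κ : Fin d → Spinor ℂ)
    (h : ∀ i j, i ≠ j → symp (κ i) (κ j) ≠ 0) : SpinPolygon d :=
  ⟨fun i => spinorHomeomorph (κ i), fun i j hij => by
    by_contra hne
    refine h i j hne ((centre_flagpole_eq_iff _ _).1 ?_)
    simpa only [spinorHomeomorph_p] using hij⟩

/-- The spinors in normal form representing an element of `X*(d)`. -/
def XNonzero.normalSpinor {a b : Fin d} (hab : a ≠ b) (ω : XNonzero d) (j : Fin d) : Spinor ℂ :=
  ⟨normalColumn a b ω.1 j, by
    obtain ⟨κ, h, hω⟩ := ω.exists_spinors hab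
    obtain ⟨A, hA⟩ := exists_smul_eq_normalColumn κ (h a b hab)
    rw [hω, ← hA]
    exact (A • κ j).2⟩

lemma XNonzero.exists_normalSpinor_eq {a b : Fin d} (hab : a ≠ b) (ω : XNonzero d)
    {κ : Fin d → Spinor ℂ} (h : symp (κ a) (κ b) ≠ 0) (hω : ω.1 = rowWedge (spinorMatrix κ)) :
    ∃ A : SL(2, ℂ), ω.normalSpinor hab = fun j => A • κ j := by
  obtain ⟨A, hA⟩ := exists_smul_eq_normalColumn κ h
  refine ⟨A, funext fun j => Subtype.ext ?_⟩
  rw [hA, ← hω]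
  rfl

lemma XNonzero.rowWedge_normalSpinor {a b : Fin d} (hab : a ≠ b) (ω : XNonzero d) :
    rowWedge (spinorMatrix (ω.normalSpinor hab)) = ω.1 := by
  obtain ⟨κ, h, hω⟩ := ω.exists_spinors hab
  obtain ⟨A, hA⟩ := ω.exists_normalSpinor_eq hab (h a b hab) hω
  rw [hA, rowWedge_smul, hω]

lemma XNonzero.symp_normalSpinor {a b : Fin d} (hab : a ≠ b) (ω : XNonzero d) (i j : Fin d)
    (hij : i ≠ j) : symp (ω.normalSpinor hab i) (ω.normalSpinor hab j) ≠ 0 := by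
  obtain ⟨κ, h, hω⟩ := ω.exists_spinors hab
  obtain ⟨A, hA⟩ := ω.exists_normalSpinor_eq hab (h a b hab) hω
  rw [hA, symp_smul]
  exact h i j hij

lemma XNonzero.continuous_normalSpinor {a b : Fin d} (hab : a ≠ b) (j : Fin d) :
    Continuous fun ω : XNonzero d => ω.normalSpinor hab j := by
  refine Continuous.subtype_mk (continuous_normalColumn (ω := fun ω : XNonzero d => ω.1)
    continuous_subtype_val (fun ω => ?_) j) _
  obtain ⟨κ, h, hω⟩ := ω.exists_spinors hab
  rw [hω, plucker_rowWedge_spinorMatrix]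
  exact h a b hab

/-- The element of `X*(d)` of a skew ideal polygon. -/
def SpinPolygon.wedge {a b : Fin d} (hab : a ≠ b) (G : SpinPolygon d) : XNonzero d :=
  ⟨rowWedge (spinorMatrix fun i => (G.1 i).spinor), rowWedge_mem_nonzero hab G.symp_ne_zero⟩

lemma SpinPolygon.continuous_wedge {a b : Fin d} (hab : a ≠ b) :
    Continuous (SpinPolygon.wedge hab) := by
  refine Continuous.subtype_mk (continuous_rowWedge fun i j => ?_) _
  simp only [plucker_rowWedge_spinorMatrix]
  have h : ∀ i, Continuous fun G : SpinPolygon d => (G.1 i).spinor := fun i =>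
    SpinDecoratedHorosphere.continuous_spinor.comp
      ((continuous_apply i).comp continuous_subtype_val)
  exact continuous_symp.comp ((h i).prodMk (h j))

/-- The identification of the Teichmüller space of skew ideal polygons with `X*(d)`. -/
def teich3Homeomorph {a b : Fin d} (hab : a ≠ b) : Teich3 d ≃ₜ XNonzero d where
  toFun := Quotient.lift (SpinPolygon.wedge hab) fun G G' hG => Subtype.ext (by
    obtain ⟨A, hA⟩ := MulAction.orbitRel_apply.1 hG
    have h : (fun i => (G.1 i).spinor) = fun i => A • (G'.1 i).spinor := funext fun i => by
      rw [← SpinDecoratedHorosphere.spinor_smul, ← congrFun hA i]; rfl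
    change rowWedge (spinorMatrix fun i => (G.1 i).spinor) = _
    rw [h, rowWedge_smul]
    rfl)
  invFun ω := Teich3.mk (SpinPolygon.ofSpinors (ω.normalSpinor hab) (ω.symp_normalSpinor hab))
  left_inv := by
    rintro ⟨G⟩
    refine Quotient.sound (MulAction.orbitRel_apply.2 ?_)
    -- The normal form is an SL(2,ℂ)-translate of the spinors of `G`, and equivariance turns this
    -- into a translate of `G` itself.
    obtain ⟨A, hA⟩ := (G.wedge hab).exists_normalSpinor_eq hab (G.symp_ne_zero a b hab) rfl
    refine ⟨A, funext fun i => ?_⟩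
    change A • G.1 i = spinorHomeomorph ((G.wedge hab).normalSpinor hab i)
    rw [hA, spinorHomeomorph_smul, spinorHomeomorph_spinor]
  right_inv ω := Subtype.ext (by
    change rowWedge (spinorMatrix fun i => (spinorHomeomorph (ω.normalSpinor hab i)).spinor) = ω.1
    simp only [spinor_spinorHomeomorph]
    exact ω.rowWedge_normalSpinor hab)
  continuous_toFun := (SpinPolygon.continuous_wedge hab).quotient_lift _
  continuous_invFun := continuous_quotient_mk'.comp (Continuous.subtype_mk
    (continuous_pi fun i => spinorHomeomorph.continuous.comp
      (XNonzero.continuous_normalSpinor hab i)) _)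

lemma coe_teich3Homeomorph_mk {a b : Fin d} (hab : a ≠ b) (G : SpinPolygon d) :
    (teich3Homeomorph hab (Teich3.mk G)).1 = rowWedge (spinorMatrix fun i => (G.1 i).spinor) :=
  rfl

end Skew

/-! ## Real spinors and horocycles -/

instance {𝕜 : Type} [RCLike 𝕜] : Neg (Spinor 𝕜) := ⟨fun κ => ⟨-κ.1, neg_ne_zero.2 κ.2⟩⟩

namespace Spinor

lemma neg_apply {𝕜 : Type} [RCLike 𝕜] (κ : Spinor 𝕜) (i : Fin 2) : (-κ).1 i = -κ.1 i := rfl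

lemma flagpole_neg {𝕜 : Type} [RCLike 𝕜] (κ : Spinor 𝕜) : (-κ).flagpole = κ.flagpole := by
  refine Subtype.ext (Matrix.ext fun i j => ?_)
  rw [flagpole_apply, flagpole_apply, neg_apply, neg_apply, map_neg, neg_mul_neg]

lemma symp_neg_left {𝕜 : Type} [RCLike 𝕜] (κ κ' : Spinor 𝕜) : symp (-κ) κ' = -symp κ κ' := by
  rw [symp, symp, neg_apply, neg_apply]; ring

lemma symp_neg_right {𝕜 : Type} [RCLike 𝕜] (κ κ' : Spinor 𝕜) : symp κ (-κ') = -symp κ κ' := by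
  rw [symp, symp, neg_apply, neg_apply]; ring

lemma flagpole_apply_real (κ : Spinor ℝ) (i j : Fin 2) : κ.flagpole.1 i j = κ.1 i * κ.1 j := rfl

lemma continuous_flagpole : Continuous (flagpole : Spinor ℝ → LightCone ℝ) := by
  refine Continuous.subtype_mk (continuous_matrix fun i j => ?_) _
  have h : ∀ i, Continuous fun κ : Spinor ℝ => κ.1 i := fun i =>
    (continuous_apply i).comp continuous_subtype_val
  exact (h i).mul (h j)

/-- A real spinor in the half-open upper half plane; every horocycle has a unique such spinor. -/
def IsUpper (κ : Spinor ℝ) : Prop := 0 < κ.1 1 ∨ κ.1 1 = 0 ∧ 0 < κ.1 0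

lemma isUpper_or_neg (κ : Spinor ℝ) : κ.IsUpper ∨ (-κ).IsUpper := by
  simp only [IsUpper, neg_apply, neg_pos, neg_eq_zero]
  rcases lt_trichotomy (κ.1 1) 0 with h | h | h
  · exact Or.inr (Or.inl h)
  · rcases lt_trichotomy (κ.1 0) 0 with h' | h' | h'
    · exact Or.inr (Or.inr ⟨h, h'⟩)
    · exact absurd (funext fun i => by fin_cases i; exacts [h', h]) κ.2
    · exact Or.inl (Or.inr ⟨h, h'⟩)
  · exact Or.inl (Or.inl h)

lemma centreReal_flagpole (κ : Spinor ℝ) : centreReal κ.flagpole =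
    if κ.1 1 = 0 then ⊤ else ((κ.1 0 / κ.1 1 : ℝ) : WithTop ℝ) := by
  rw [centreReal, flagpole_apply_real, flagpole_apply_real]
  by_cases h : κ.1 1 = 0
  · simp [h]
  · rw [if_neg (mul_ne_zero h h), if_neg h, mul_div_mul_right _ _ h]

/-- For positive second entries, dividing `ξη' - ηξ'` by `ηη'` compares the centres. The boundary
case `η = 0`, `ξ > 0` is the centre `∞`, consistent with `∞` being largest. -/
lemma centreReal_lt_iff {κ κ' : Spinor ℝ} (h : κ.IsUpper) (h' : κ'.IsUpper) :
    centreReal κ'.flagpole < centreReal κ.flagpole ↔ 0 < symp κ κ' := by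
  rw [centreReal_flagpole, centreReal_flagpole, symp]
  rcases h with h | ⟨h, h0⟩ <;> rcases h' with h' | ⟨h', h0'⟩
  · rw [if_neg h.ne', if_neg h'.ne', WithTop.coe_lt_coe, div_lt_div_iff₀ h' h, sub_pos,
      mul_comm (κ.1 1)]
  · rw [if_pos h', h']
    simp only [not_top_lt, mul_zero, zero_sub, Left.neg_pos_iff, false_iff, not_lt]
    positivity
  · rw [if_pos h, if_neg h'.ne', h]
    simp only [WithTop.coe_lt_top, zero_mul, sub_zero, true_iff]
    positivity
  · simp [h, h']

end Spinor

lemma LightCone.exists_isUpper (p : LightCone ℝ) : ∃ κ : Spinor ℝ, κ.IsUpper ∧ κ.flagpole = p := by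
  obtain ⟨κ, hκ⟩ := p.exists_flagpole
  rcases κ.isUpper_or_neg with h | h
  · exact ⟨κ, h, hκ⟩
  · exact ⟨-κ, h, by rw [Spinor.flagpole_neg, hκ]⟩

/-- The horocycles see the form only up to sign; total positivity supplies the missing sign. -/
lemma mink_flagpole (κ κ' : Spinor ℝ) : mink κ.flagpole.1 κ'.flagpole.1 = 2 * symp κ κ' ^ 2 := by
  rw [mink_fin_two]
  simp only [Spinor.flagpole_apply_real, RCLike.re_to_real, symp]
  ring

/-! ## Totally positive lifts of decorated ideal polygons -/

section Lift

variable {d : ℕ}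

/-- A totally positive lift of a tuple of horocycles to real spinors. -/
def IsPositiveLift (h : Fin d → LightCone ℝ) (κ : Fin d → Spinor ℝ) : Prop :=
  IsTotallyPositive κ ∧ ∀ i, (κ i).flagpole = h i

/-- Moving `κ₀` to the end reverses its pairings, so it must return as `-κ₀`: `{κ_i, -κ₀} = {κ₀,
κ_i} > 0`. The horocycle of `κ₀` is unaffected. -/
lemma IsPositiveLift.rotate {h : Fin d → LightCone ℝ} {κ : Fin d → Spinor ℝ}
    (hκ : IsPositiveLift h κ) : ∃ κ', IsPositiveLift (fun i => h (finRotate d i)) κ' := by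
  cases d with
  | zero => exact ⟨κ, fun i => i.elim0, fun i => i.elim0⟩
  | succ n =>
    refine ⟨Fin.snoc (α := fun _ => Spinor ℝ) (fun i => κ i.succ) (-κ 0), fun i j => ?_,
      fun i => ?_⟩
    · induction j using Fin.lastCases with
      | last =>
        induction i using Fin.lastCases with
        | last => exact fun hij => absurd hij (lt_irrefl _)
        | cast i =>
          intro _
          rw [Fin.snoc_last, Fin.snoc_castSucc, Spinor.symp_neg_right, ← symp_swap]
          exact hκ.1 0 i.succ i.succ_pos
      | cast j =>
        induction i using Fin.lastCases with
        | last => exact fun hij => absurd hij (not_lt_of_ge (Fin.le_last _))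
        | cast i =>
          intro hij
          rw [Fin.snoc_castSucc, Fin.snoc_castSucc]
          exact hκ.1 _ _ (Fin.succ_lt_succ_iff.2 (Fin.castSucc_lt_castSucc_iff.1 hij))
    · induction i using Fin.lastCases with
      | last =>
        change _ = h (finRotate (n + 1) (Fin.last n))
        rw [Fin.snoc_last, finRotate_last, Spinor.flagpole_neg, hκ.2]
      | cast i =>
        change _ = h (finRotate (n + 1) i.castSucc)
        rw [Fin.snoc_castSucc, finRotate_apply, Fin.coeSucc_eq_succ, hκ.2]

lemma IsPositiveLift.rotate_pow {h : Fin d → LightCone ℝ} {κ : Fin d → Spinor ℝ}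
    (hκ : IsPositiveLift h κ) (k : ℕ) :
    ∃ κ', IsPositiveLift (fun i => h ((finRotate d ^ k) i)) κ' := by
  induction k with
  | zero => exact ⟨κ, hκ⟩
  | succ k ih =>
    obtain ⟨κ', hκ'⟩ := ih
    rw [pow_succ]
    exact hκ'.rotate

/-- After a rotation the centres decrease, and then the upper half plane representatives are totally
positive. Positivity survives rotating back. -/
lemma DecoratedPolygon.exists_isPositiveLift (G : DecoratedPolygon d) :
    ∃ κ, IsPositiveLift G.1 κ := by
  obtain ⟨h, k, hk⟩ := G
  choose κ hup hflag using fun i => (h ((finRotate d ^ k) i)).exists_isUpper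
  have hκ : IsPositiveLift (fun i => h ((finRotate d ^ k) i)) κ := by
    refine ⟨fun i j hij => (Spinor.centreReal_lt_iff (hup i) (hup j)).1 ?_, hflag⟩
    rw [hflag, hflag]
    exact hk hij
  -- Only forward rotations are available, so the rotation is undone by completing `k` to a multiple
  -- of the order.
  obtain ⟨κ', hκ'⟩ := hκ.rotate_pow (k * (orderOf (finRotate d) - 1))
  refine ⟨κ', ?_⟩
  have hid : ∀ i, (finRotate d ^ k) ((finRotate d ^ (k * (orderOf (finRotate d) - 1))) i) = i :=
    fun i => by
      have hpos := orderOf_pos (finRotate d)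
      rw [← Equiv.Perm.mul_apply, ← pow_add,
        show k + k * (orderOf (finRotate d) - 1) = orderOf (finRotate d) * k by
          obtain ⟨n, hn⟩ := Nat.exists_eq_succ_of_ne_zero hpos.ne'
          rw [hn, Nat.succ_sub_one, Nat.succ_mul]
          ring,
        pow_mul, pow_orderOf_eq_one, one_pow, Equiv.Perm.one_apply]
  simpa only [hid] using hκ'

lemma exists_finRotate_pow_eq {n : ℕ} (m : Fin (n + 1)) : ∃ k, (finRotate (n + 1) ^ k) 0 = m := by
  induction m using Fin.induction with
  | zero => exact ⟨0, rfl⟩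
  | succ i ih =>
    obtain ⟨k, hk⟩ := ih
    exact ⟨k + 1, by
      rw [pow_succ', Equiv.Perm.mul_apply, hk, finRotate_apply, Fin.coeSucc_eq_succ]⟩

/-- Rotate so that the largest centre comes first and, by a global sign change, make its spinor
upper. If some later `-κ_i` were upper, positivity of `{κ₀, κ_i}` would place its centre beyond the
largest one; so all spinors are upper and the form gives the order. -/
lemma IsPositiveLift.exists_strictAnti {h : Fin d → LightCone ℝ} {κ : Fin d → Spinor ℝ}
    (hκ : IsPositiveLift h κ) :
    ∃ k : ℕ, StrictAnti fun i : Fin d => centreReal (h ((finRotate d ^ k) i)) := by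
  cases d with
  | zero => exact ⟨0, fun i => i.elim0⟩
  | succ n =>
    obtain ⟨m, hm⟩ := Finite.exists_max fun i => centreReal (h i)
    obtain ⟨k, rfl⟩ := exists_finRotate_pow_eq m
    refine ⟨k, ?_⟩
    have key : ∃ κ', IsPositiveLift (fun i => h ((finRotate (n + 1) ^ k) i)) κ' ∧
        (κ' 0).IsUpper := by
      obtain ⟨κ', hκ'⟩ := hκ.rotate_pow k
      rcases (κ' 0).isUpper_or_neg with h0 | h0
      · exact ⟨κ', hκ', h0⟩
      · refine ⟨fun i => -κ' i, ⟨fun i j hij => ?_, fun i => ?_⟩, h0⟩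
        · rw [Spinor.symp_neg_left, Spinor.symp_neg_right, neg_neg]
          exact hκ'.1 i j hij
        · rw [Spinor.flagpole_neg, hκ'.2]
    obtain ⟨κ', hκ', h0⟩ := key
    have hup : ∀ i, (κ' i).IsUpper := fun i => by
      rcases eq_or_ne i 0 with rfl | hi
      · exact h0
      refine (κ' i).isUpper_or_neg.resolve_right fun hneg => ?_
      have hlt := (Spinor.centreReal_lt_iff hneg h0).2 (by
        rw [Spinor.symp_neg_left, ← symp_swap]
        exact hκ'.1 0 i (Fin.pos_of_ne_zero hi))
      rw [Spinor.flagpole_neg, hκ'.2, hκ'.2] at hlt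
      exact absurd (hm _) (not_le_of_gt hlt)
    intro i j hij
    change centreReal (h ((finRotate (n + 1) ^ k) j)) < centreReal (h ((finRotate (n + 1) ^ k) i))
    have hflag : ∀ i, (κ' i).flagpole = h ((finRotate (n + 1) ^ k) i) := hκ'.2
    rw [← hflag, ← hflag]
    exact (Spinor.centreReal_lt_iff (hup i) (hup j)).2 (hκ'.1 i j hij)

/-- The decorated ideal polygon of a totally positive tuple of real spinors. -/
def DecoratedPolygon.ofSpinors (κ : Fin d → Spinor ℝ) (h : IsTotallyPositive κ) :
    DecoratedPolygon d :=
  ⟨fun i => (κ i).flagpole, IsPositiveLift.exists_strictAnti ⟨h, fun _ => rfl⟩⟩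

/-- A totally positive lift of a decorated ideal polygon. -/
def DecoratedPolygon.lift (G : DecoratedPolygon d) : Fin d → Spinor ℝ :=
  G.exists_isPositiveLift.choose

lemma DecoratedPolygon.isPositiveLift (G : DecoratedPolygon d) : IsPositiveLift G.1 G.lift :=
  G.exists_isPositiveLift.choose_spec

lemma IsPositiveLift.symp_eq_sqrt {h : Fin d → LightCone ℝ} {κ : Fin d → Spinor ℝ}
    (hκ : IsPositiveLift h κ) {i j : Fin d} (hij : i < j) :
    symp (κ i) (κ j) = √(mink (h i).1 (h j).1 / 2) := by
  rw [← hκ.2 i, ← hκ.2 j, mink_flagpole, mul_div_cancel_left₀ _ two_ne_zero,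
    Real.sqrt_sq (hκ.1 i j hij).le]

lemma IsPositiveLift.symp_eq {h : Fin d → LightCone ℝ} {κ κ' : Fin d → Spinor ℝ}
    (hκ : IsPositiveLift h κ) (hκ' : IsPositiveLift h κ') (i j : Fin d) :
    symp (κ i) (κ j) = symp (κ' i) (κ' j) := by
  rcases lt_trichotomy i j with hij | rfl | hij
  · rw [hκ.symp_eq_sqrt hij, hκ'.symp_eq_sqrt hij]
  · rw [symp_self, symp_self]
  · rw [symp_swap, symp_swap (κ' i), hκ.symp_eq_sqrt hij, hκ'.symp_eq_sqrt hij]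

/-- Both tuples have the same normal form, which depends only on the form values, and moving to it
leaves the wedge unchanged. -/
lemma rowWedge_eq_of_symp_eq {𝕜 : Type} [RCLike 𝕜] {κ κ' : Fin d → Spinor 𝕜} {a b : Fin d}
    (hab : symp (κ a) (κ b) ≠ 0) (h : ∀ i j, symp (κ i) (κ j) = symp (κ' i) (κ' j)) :
    rowWedge (spinorMatrix κ) = rowWedge (spinorMatrix κ') := by
  obtain ⟨A, hA⟩ := exists_smul_eq_normalColumn κ hab
  obtain ⟨A', hA'⟩ := exists_smul_eq_normalColumn κ' (h a b ▸ hab)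
  rw [← rowWedge_smul A κ, ← rowWedge_smul A' κ']
  congr 2
  refine funext fun j => Subtype.ext ?_
  rw [hA, hA', normalColumn, normalColumn]
  simp only [plucker_rowWedge_spinorMatrix, h]

lemma IsPositiveLift.rowWedge_eq {h : Fin d → LightCone ℝ} {κ κ' : Fin d → Spinor ℝ}
    {a b : Fin d} (hab : a < b) (hκ : IsPositiveLift h κ) (hκ' : IsPositiveLift h κ') :
    rowWedge (spinorMatrix κ) = rowWedge (spinorMatrix κ') :=
  rowWedge_eq_of_symp_eq (hκ.1 a b hab).ne' (hκ.symp_eq hκ')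

lemma IsPositiveLift.smul {h : Fin d → LightCone ℝ} {κ : Fin d → Spinor ℝ}
    (hκ : IsPositiveLift h κ) (A : SL(2, ℝ)) :
    IsPositiveLift (fun i => A • h i) fun i => A • κ i :=
  ⟨fun i j hij => by rw [symp_smul]; exact hκ.1 i j hij, fun i => by
    rw [Spinor.flagpole_smul, hκ.2]⟩

end Lift

/-! ## Decorated ideal polygons -/

section Planar

variable {d : ℕ}

lemma rowWedge_mem_positive {κ : Fin d → Spinor ℝ} {a b : Fin d} (hab : a < b)
    (h : IsTotallyPositive κ) :
    rowWedge (spinorMatrix κ) ∈ affineCone (positiveGrassmannian d) ∧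
      ∀ i j, i < j → 0 < plucker i j (rowWedge (spinorMatrix κ)) := by
  have hp : ∀ i j, i < j → 0 < plucker i j (rowWedge (spinorMatrix κ)) := fun i j hij => by
    rw [plucker_rowWedge_spinorMatrix]
    exact h i j hij
  have hm : ∀ i j, i < j → 0 < minor (spinorMatrix κ) i j := fun i j hij => by
    rw [← plucker_rowWedge]
    exact hp i j hij
  exact ⟨⟨spinorMatrix κ, linearIndependent_row (hm a b hab).ne',
    ⟨spinorMatrix κ, hm, rfl⟩, rfl⟩, hp⟩

lemma XPos.exists_spinors {a b : Fin d} (hab : a < b) (ω : XPos d) :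
    ∃ κ : Fin d → Spinor ℝ, IsTotallyPositive κ ∧ ω.1 = rowWedge (spinorMatrix κ) := by
  obtain ⟨ω, ⟨M, -, -, rfl⟩, hM⟩ := ω
  obtain ⟨κ, rfl⟩ := exists_spinorMatrix_eq (M := M) fun i => by
    rcases lt_or_ge i b with hi | hi
    · exact ⟨b, by rw [← plucker_rowWedge]; exact (hM i b hi).ne'⟩
    · refine ⟨a, fun hz => (hM a i (hab.trans_le hi)).ne' ?_⟩
      rw [plucker_rowWedge, minor_apply]
      rw [minor_apply] at hz
      linear_combination -hz
  refine ⟨κ, fun i j hij => ?_, rfl⟩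
  rw [← plucker_rowWedge_spinorMatrix]
  exact hM i j hij

/-- The real spinors in normal form representing an element of `X⁺(d)`. -/
def XPos.normalSpinor {a b : Fin d} (hab : a < b) (ω : XPos d) (j : Fin d) : Spinor ℝ :=
  ⟨normalColumn a b ω.1 j, by
    obtain ⟨κ, h, hω⟩ := ω.exists_spinors hab
    obtain ⟨A, hA⟩ := exists_smul_eq_normalColumn κ (h a b hab).ne'
    rw [hω, ← hA]
    exact (A • κ j).2⟩

lemma XPos.exists_normalSpinor_eq {a b : Fin d} (hab : a < b) (ω : XPos d)
    {κ : Fin d → Spinor ℝ} (h : IsTotallyPositive κ) (hω : ω.1 = rowWedge (spinorMatrix κ)) :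
    ∃ A : SL(2, ℝ), ω.normalSpinor hab = fun j => A • κ j := by
  obtain ⟨A, hA⟩ := exists_smul_eq_normalColumn κ (h a b hab).ne'
  refine ⟨A, funext fun j => Subtype.ext ?_⟩
  rw [hA, ← hω]
  rfl

lemma XPos.rowWedge_normalSpinor {a b : Fin d} (hab : a < b) (ω : XPos d) :
    rowWedge (spinorMatrix (ω.normalSpinor hab)) = ω.1 := by
  obtain ⟨κ, h, hω⟩ := ω.exists_spinors hab
  obtain ⟨A, hA⟩ := ω.exists_normalSpinor_eq hab h hω
  rw [hA, rowWedge_smul, hω]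

lemma XPos.isTotallyPositive_normalSpinor {a b : Fin d} (hab : a < b) (ω : XPos d) :
    IsTotallyPositive (ω.normalSpinor hab) := by
  obtain ⟨κ, h, hω⟩ := ω.exists_spinors hab
  obtain ⟨A, hA⟩ := ω.exists_normalSpinor_eq hab h hω
  intro i j hij
  rw [hA, symp_smul]
  exact h i j hij

lemma XPos.continuous_normalSpinor {a b : Fin d} (hab : a < b) (j : Fin d) :
    Continuous fun ω : XPos d => ω.normalSpinor hab j :=
  Continuous.subtype_mk (continuous_normalColumn (ω := fun ω : XPos d => ω.1)
    continuous_subtype_val (fun ω => (ω.2.2 a b hab).ne') j) _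

/-- The element of `X⁺(d)` of a decorated ideal polygon. -/
def DecoratedPolygon.wedge {a b : Fin d} (hab : a < b) (G : DecoratedPolygon d) : XPos d :=
  ⟨rowWedge (spinorMatrix G.lift), rowWedge_mem_positive hab G.isPositiveLift.1⟩

lemma DecoratedPolygon.coe_wedge {a b : Fin d} (hab : a < b) (G : DecoratedPolygon d)
    {κ : Fin d → Spinor ℝ} (hκ : IsPositiveLift G.1 κ) :
    (G.wedge hab).1 = rowWedge (spinorMatrix κ) :=
  G.isPositiveLift.rowWedge_eq hab hκ

/-- The lift is an arbitrary choice, but its Plücker coordinates are, up to sign, square roots of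
Minkowski products of the horocycles, hence continuous. -/
lemma DecoratedPolygon.continuous_wedge {a b : Fin d} (hab : a < b) :
    Continuous (DecoratedPolygon.wedge hab) := by
  refine Continuous.subtype_mk (continuous_rowWedge fun i j => ?_) _
  have hlt : ∀ i j : Fin d, i < j →
      Continuous fun G : DecoratedPolygon d => symp (G.lift i) (G.lift j) := fun i j hij => by
    have heq : (fun G : DecoratedPolygon d => symp (G.lift i) (G.lift j)) =
        fun G => √(mink (G.1 i).1 (G.1 j).1 / 2) :=
      funext fun G => G.isPositiveLift.symp_eq_sqrt hij
    rw [heq]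
    have h : ∀ i k l, Continuous fun G : DecoratedPolygon d => (G.1 i).1 k l := fun i k l =>
      (continuous_subtype_val.comp
        ((continuous_apply i).comp continuous_subtype_val)).matrix_elem k l
    refine Real.continuous_sqrt.comp (Continuous.div_const ?_ 2)
    simp only [mink_fin_two, RCLike.re_to_real]
    exact continuous_const.mul (((((h i 0 0).mul (h j 1 1)).add ((h i 1 1).mul (h j 0 0))).sub
      ((h i 0 1).mul (h j 1 0))).sub ((h i 1 0).mul (h j 0 1)))
  simp only [plucker_rowWedge_spinorMatrix]
  rcases lt_trichotomy i j with hij | rfl | hij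
  · exact hlt i j hij
  · simp only [symp_self]
    exact continuous_const
  · have heq : (fun G : DecoratedPolygon d => symp (G.lift i) (G.lift j)) =
        fun G => -symp (G.lift j) (G.lift i) := funext fun G => symp_swap _ _
    rw [heq]
    exact (hlt j i hij).neg

/-- The identification of the decorated Teichmüller space with `X⁺(d)`. -/
def teichHomeomorph {a b : Fin d} (hab : a < b) : Teich d ≃ₜ XPos d where
  toFun := Quotient.lift (DecoratedPolygon.wedge hab) fun G G' hG => Subtype.ext (by
    obtain ⟨A, hA⟩ := MulAction.orbitRel_apply.1 hG
    -- Translating a positive lift of `G'` gives one of `G`, and the wedge does not depend on the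
    -- lift.
    have hκ : IsPositiveLift G.1 fun i => A • G'.lift i := by
      rw [← hA]
      exact G'.isPositiveLift.smul A
    rw [G.coe_wedge hab hκ, G'.coe_wedge hab G'.isPositiveLift, rowWedge_smul])
  invFun ω := Teich.mk
    (DecoratedPolygon.ofSpinors (ω.normalSpinor hab) (ω.isTotallyPositive_normalSpinor hab))
  left_inv := by
    rintro ⟨G⟩
    refine Quotient.sound (MulAction.orbitRel_apply.2 ?_)
    obtain ⟨A, hA⟩ := (G.wedge hab).exists_normalSpinor_eq hab G.isPositiveLift.1 rfl
    refine ⟨A, funext fun i => ?_⟩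
    change A • G.1 i = ((G.wedge hab).normalSpinor hab i).flagpole
    rw [hA, Spinor.flagpole_smul, G.isPositiveLift.2]
  right_inv ω := Subtype.ext (by
    change (DecoratedPolygon.wedge hab _).1 = ω.1
    rw [DecoratedPolygon.coe_wedge hab _
      ⟨ω.isTotallyPositive_normalSpinor hab, fun _ => rfl⟩, ω.rowWedge_normalSpinor])
  continuous_toFun := (DecoratedPolygon.continuous_wedge hab).quotient_lift _
  continuous_invFun := continuous_quotient_mk'.comp (Continuous.subtype_mk
    (continuous_pi fun i => Spinor.continuous_flagpole.comp
      (XPos.continuous_normalSpinor hab i)) _)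

lemma coe_teichHomeomorph_mk {a b : Fin d} (hab : a < b) (G : DecoratedPolygon d)
    {κ : Fin d → Spinor ℝ} (hκ : IsPositiveLift G.1 κ) :
    (teichHomeomorph hab (Teich.mk G)).1 = rowWedge (spinorMatrix κ) :=
  G.coe_wedge hab hκ

/-- At a real point the whole spin frame `A` is real, and a real `A` of determinant one fixes `[[0,
i], [-i, 0]]`, because `A J Aᵀ = (det A) J` for antisymmetric `J`. -/
lemma isPlanar_spinorHomeomorph (κ : Spinor ℝ) :
    IsPlanar κ.flagpole (spinorHomeomorph κ.ofReal) := by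
  constructor
  · rw [spinorHomeomorph_p]
    ext i j
    rw [Matrix.map_apply, Spinor.flagpole_apply, Spinor.flagpole_apply_real]
    change (κ.1 i : ℂ) * conj (κ.1 j : ℂ) = _
    rw [Complex.conj_ofReal]
    push_cast
    rfl
  · rintro q ⟨S, hS⟩
    have hcol : ∀ i, ((spinorHomeomorph κ.ofReal).wout q).1 i 0 = (κ.1 i : ℂ) := fun i => by
      rw [← Spinor.smul_std_apply, SpinDecoratedHorosphere.wout_smul_std, spinor_spinorHomeomorph]
      rfl
    rw [← (spinorHomeomorph κ.ofReal).pt_wout] at hS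
    rw [SpinDecoratedHorosphere.decoration]
    set A := (spinorHomeomorph κ.ofReal).wout q
    have hdet := A.2
    rw [Matrix.det_fin_two, hcol, hcol] at hdet
    have h01 := congrArg Complex.im (congrFun (congrFun hS 0) 1)
    rw [SpinFrame.pt_apply, hcol, hcol, Matrix.map_apply, Complex.ofReal_im] at h01
    have hre := congrArg Complex.re hdet
    have him := congrArg Complex.im hdet
    simp at h01 hre him
    -- The imaginary part of the second column is parallel to `κ` (imaginary part of the
    -- determinant) and to its own real part (reality of the point). These two are independent by
    -- the real part of the determinant, so it vanishes.
    have h0 : (A.1 0 1).im = 0 := by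
      linear_combination (-(A.1 0 1).im) * hre + (A.1 0 1).re * him + κ.1 0 * h01
    have h1 : (A.1 1 1).im = 0 := by
      linear_combination (-(A.1 1 1).im) * hre + (A.1 1 1).re * him + κ.1 1 * h01
    have hreal : ∀ i, conj (A.1 i 1) = A.1 i 1 := fun i => by
      rw [Complex.conj_eq_iff_im]
      fin_cases i
      · exact h0
      · exact h1
    ext i j
    rw [SpinFrame.vec₂_apply, hreal, hcol, hcol, Complex.conj_ofReal]
    fin_cases i <;> fin_cases j <;> simp
    · ring
    · linear_combination (Complex.I / 2) * hdet
    · linear_combination (-Complex.I / 2) * hdet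
    · ring

/-! ## Lambda lengths of horocycles -/

lemma mink_comb (κ κ' : Spinor ℝ) (a b a' b' : ℝ) :
    mink (a • κ.flagpole.1 + b • κ'.flagpole.1) (a' • κ.flagpole.1 + b' • κ'.flagpole.1) =
      2 * (a * b' + b * a') * symp κ κ' ^ 2 := by
  rw [mink_fin_two]
  simp only [Matrix.add_apply, Matrix.smul_apply, Spinor.flagpole_apply_real, RCLike.re_to_real,
    smul_eq_mul, symp]
  ring

/-- A point of the geodesic joining the centres of the horocycles of two spinors. -/
def geodesicPoint (κ κ' : Spinor ℝ) (a b : ℝ) (ha : 0 < a) (hb : 0 < b)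
    (h : 4 * a * b * symp κ κ' ^ 2 = 1) : Hyp ℝ :=
  ⟨a • κ.flagpole.1 + b • κ'.flagpole.1, by
    refine Matrix.IsHermitian.ext fun i j => ?_
    simp only [Matrix.add_apply, Matrix.smul_apply, Spinor.flagpole_apply_real, smul_eq_mul,
      star_trivial]
    ring, by
    rw [mink_comb]
    linear_combination h, by
    have h1 := κ.flagpole.2.2.2
    have h2 := κ'.flagpole.2.2.2
    simp only [RCLike.re_to_real] at h1 h2 ⊢
    rw [Matrix.trace_add, Matrix.trace_smul, Matrix.trace_smul, smul_eq_mul, smul_eq_mul]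
    positivity⟩

/-- At a geodesic point `a p + b p'`, the first horocycle forces `b = 1/(2D²)` and the hyperboloid
`a = 1/2`. Travelling a distance `ρ` turns the coefficient of `p` into `exp (-ρ)/2`, and the second
horocycle requires it to be `1/(2D²)`; thus `exp ρ = D²`, with root `D > 0`. -/
lemma isRealLambdaLength_flagpole_iff {κ κ' : Spinor ℝ} (h : 0 < symp κ κ') (l : ℝ) :
    IsRealLambdaLength κ.flagpole κ'.flagpole l ↔ l = symp κ κ' := by
  set D := symp κ κ' with hD
  have hfst : ∀ a b, mink (a • κ.flagpole.1 + b • κ'.flagpole.1) κ.flagpole.1 = 2 * b * D ^ 2 :=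
    fun a b => by
      have := mink_comb κ κ' a b 1 0
      simpa using this
  have hsnd : ∀ a b, mink (a • κ.flagpole.1 + b • κ'.flagpole.1) κ'.flagpole.1 = 2 * a * D ^ 2 :=
    fun a b => by
      have := mink_comb κ κ' a b 0 1
      simpa using this
  have hcomb : ∀ ρ a b : ℝ, Real.cosh ρ • (a • κ.flagpole.1 + b • κ'.flagpole.1) +
      Real.sinh ρ • (a • κ.flagpole.1 + b • κ'.flagpole.1 - κ.flagpole.1) =
      (Real.exp ρ * a - Real.sinh ρ) • κ.flagpole.1 + (Real.exp ρ * b) • κ'.flagpole.1 :=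
    fun ρ a b => by
      rw [← Real.cosh_add_sinh]
      module
  constructor
  · rintro ⟨q₁, q₂, ρ, ⟨a, b, hq₁⟩, -, hq, rfl⟩
    have h1 : mink q₁.1.1 κ.flagpole.1 = 1 := q₁.2
    have h2 : mink q₂.1.1 κ'.flagpole.1 = 1 := q₂.2
    have hself : mink q₁.1.1 q₁.1.1 = 1 := q₁.1.2.2.1
    rw [inwardNormal, hq₁, hcomb] at hq
    rw [hq, hsnd] at h2
    rw [hq₁, hfst] at h1
    rw [hq₁, mink_comb, ← hD] at hself
    have ha : a = 1 / 2 := by linear_combination (1 / 2) * hself - a * h1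
    rw [ha, Real.sinh_eq] at h2
    have hexp : Real.exp (-ρ) * D ^ 2 = 1 := by linear_combination h2
    have hsq : Real.exp (ρ / 2) ^ 2 = D ^ 2 := by
      rw [← Real.exp_nat_mul]
      push_cast
      rw [mul_div_cancel₀ _ (two_ne_zero), ← mul_one (Real.exp ρ), ← hexp, ← mul_assoc,
        ← Real.exp_add, add_neg_cancel, Real.exp_zero, one_mul]
    exact (pow_left_inj₀ (Real.exp_pos _).le h.le two_ne_zero).1 hsq
  · intro hl
    have hD0 : D ≠ 0 := h.ne'
    let q₁ := geodesicPoint κ κ' (1 / 2) (1 / (2 * D ^ 2)) (by positivity) (by positivity) (by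
      rw [← hD]; field_simp; norm_num)
    let q₂ := geodesicPoint κ κ' (1 / (2 * D ^ 2)) (1 / 2) (by positivity) (by positivity) (by
      rw [← hD]; field_simp; norm_num)
    have hexp : Real.exp (2 * Real.log D) = D ^ 2 := by
      rw [two_mul, Real.exp_add, Real.exp_log h, sq]
    refine ⟨⟨q₁, ?_⟩, ⟨q₂, ?_⟩, 2 * Real.log D, ⟨_, _, rfl⟩, ⟨_, _, rfl⟩, ?_, ?_⟩
    · change mink _ _ = 1
      refine (hfst _ _).trans ?_
      field_simp
    · change mink _ _ = 1
      refine (hsnd _ _).trans ?_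
      field_simp
    · refine Eq.trans ?_ (hcomb _ _ _).symm
      rw [Real.sinh_eq, Real.exp_neg, hexp]
      change _ • _ + _ • _ = _
      congr 2 <;> field_simp
      ring
    · rw [mul_div_cancel_left₀ _ two_ne_zero, Real.exp_log h, hl]

end Planar

end SpinHoro

end

/-! ### The main theorem -/

open SpinHoro in
theorem theorem4 :
    ∃ Ψ : Spinor ℂ ≃ₜ SpinDecoratedHorosphere, IsSpinorCorrespondence Ψ ∧
      ∀ d : ℕ, 3 ≤ d →
        (∃ Θ : Teich d ≃ₜ XPos d,
          (∀ κ : Fin d → Spinor ℝ, IsTotallyPositive κ →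
            ∃ G : DecoratedPolygon d, (∀ i, IsPlanar (G.1 i) (Ψ (κ i).ofReal)) ∧
              (Θ (Teich.mk G)).1 = rowWedge (spinorMatrix κ)) ∧
          (∀ G : DecoratedPolygon d, ∃ κ : Fin d → Spinor ℝ, IsTotallyPositive κ ∧
            (∀ i, IsPlanar (G.1 i) (Ψ (κ i).ofReal)) ∧
              (Θ (Teich.mk G)).1 = rowWedge (spinorMatrix κ)) ∧
          (∀ (G : DecoratedPolygon d) (i j : Fin d), i < j → ∀ l : ℝ,
            IsRealLambdaLength (G.1 i) (G.1 j) l ↔ l = plucker i j (Θ (Teich.mk G)).1)) ∧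
        (∃ Θ : Teich3 d ≃ₜ XNonzero d,
          (∀ (G : SpinPolygon d) (κ : Fin d → Spinor ℂ), (∀ i, G.1 i = Ψ (κ i)) →
            (Θ (Teich3.mk G)).1 = rowWedge (spinorMatrix κ)) ∧
          (∀ (G : SpinPolygon d) (i j : Fin d) (l : ℂ),
            IsComplexLambdaLength (G.1 i) (G.1 j) l ↔
              l = plucker i j (Θ (Teich3.mk G)).1)) := by
  refine ⟨spinorHomeomorph, ⟨spinorHomeomorph_smul, liesOver_spinorHomeomorph⟩, fun d hd => ?_⟩
  -- The normal forms are taken with respect to the first two columns.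
  have hab : (⟨0, by omega⟩ : Fin d) < ⟨1, by omega⟩ := Fin.mk_lt_mk.2 zero_lt_one
  refine ⟨⟨teichHomeomorph hab, fun κ hκ => ?_, fun G => ?_, fun G i j hij l => ?_⟩,
    ⟨teich3Homeomorph hab.ne, fun G κ hG => ?_, fun G i j l => ?_⟩⟩
  · exact ⟨DecoratedPolygon.ofSpinors κ hκ, fun i => isPlanar_spinorHomeomorph (κ i),
      coe_teichHomeomorph_mk hab _ ⟨hκ, fun _ => rfl⟩⟩
  · refine ⟨G.lift, G.isPositiveLift.1, fun i => ?_, coe_teichHomeomorph_mk hab _ G.isPositiveLift⟩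
    rw [← G.isPositiveLift.2 i]
    exact isPlanar_spinorHomeomorph _
  · rw [coe_teichHomeomorph_mk hab _ G.isPositiveLift, plucker_rowWedge_spinorMatrix,
      ← isRealLambdaLength_flagpole_iff (G.isPositiveLift.1 i j hij), G.isPositiveLift.2,
      G.isPositiveLift.2]
  · rw [coe_teich3Homeomorph_mk]
    simp only [hG, spinor_spinorHomeomorph]
  · rw [coe_teich3Homeomorph_mk, plucker_rowWedge_spinorMatrix, isComplexLambdaLength_iff]
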